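/- **Theorem 6.1** (Half-space theorem in $\widetilde{E(2)}$). Let $\lambda_1\ge\lambda_2>0$, and let $\widetilde{E(2)}$ be $\mathbb{R}^3$, with coordinates $(x_1,x_2,x_3)$, the group law $$(x_1,x_2,x_3)*(y_1,y_2,y_3)=(x_1+y_1\cos x_3-y_2\sin x_3,\ x_2+y_1\sin x_3+y_2\cos x_3,\ x_3+y_3)$$ and the left-invariant Riemannian metric $$\lambda_1^2(\cos x_3\,dx_1+\sin x_3\,dx_2)^2+\lambda_2^2(-\sin x_3\,dx_1+\cos x_3\,dx_2)^2+\frac{1}{\lambda_1^2\lambda_2^2}\,dx_3^2 .$$ Let $\Sigma$ be a connected smooth surface without boundary and let $f:\Sigma\to\widetilde{E(2)}$ be a proper smooth immersion which is minimal, i.e. has zero mean curvature. Suppose that $f(\Sigma)$ lies on one side of a plane parallel to $\{x_3=0\}$: there is $a\in\mathbb{R}$ such that $x_3\le a$ on all of $f(\Sigma)$, or $x_3\ge a$ on all of $f(\Sigma)$. Then $\Sigma$ is a plane parallel to $\{x_3=0\}$: there is $b\in\mathbb{R}$ such that $f$ is injective and $f(\Sigma)=\{x_3=b\}$. -/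

import Mathlib

open scoped Manifold ContDiff

noncomputable section

/-- The underlying manifold `ℝ³` of the universal covering of the group of rigid motions of the
Euclidean plane, with its global coordinates `p 0, p 1, p 2` (that is, `x₁, x₂, x₃`). -/
abbrev E2Tilde : Type := EuclideanSpace ℝ (Fin 3)

/-- A coordinate domain of a surface. -/
abbrev Plane2 : Type := EuclideanSpace ℝ (Fin 2)

namespace E2Tilde

/-- The group law of the universal covering of `E(2)`. -/
def mul (p q : E2Tilde) : E2Tilde :=
  !₂[p 0 + q 0 * Real.cos (p 2) - q 1 * Real.sin (p 2),
     p 1 + q 0 * Real.sin (p 2) + q 1 * Real.cos (p 2),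
     p 2 + q 2]

/-- The Riemannian metric
`l₁² (cos z dx + sin z dy)² + l₂² (-sin z dx + cos z dy)² + (l₁ l₂)⁻² dz²`,
evaluated at the point `p` (where `z = p 2`) on the tangent vectors `v`, `w` (in the coordinate frame). -/
def metric (l₁ l₂ : ℝ) (p v w : E2Tilde) : ℝ :=
  l₁ ^ 2 * (Real.cos (p 2) * v 0 + Real.sin (p 2) * v 1)
      * (Real.cos (p 2) * w 0 + Real.sin (p 2) * w 1)
    + l₂ ^ 2 * (-Real.sin (p 2) * v 0 + Real.cos (p 2) * v 1)
      * (-Real.sin (p 2) * w 0 + Real.cos (p 2) * w 1)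
    + 1 / (l₁ ^ 2 * l₂ ^ 2) * (v 2 * w 2)

/-- The differential of a left translation. -/
theorem fderiv_mul_left (a p v : E2Tilde) :
    fderiv ℝ (mul a) p v =
      !₂[v 0 * Real.cos (a 2) - v 1 * Real.sin (a 2),
         v 0 * Real.sin (a 2) + v 1 * Real.cos (a 2), v 2] := by
  have hd : DifferentiableAt ℝ (mul a) p := by
    rw [differentiableAt_euclidean]
    intro i
    fin_cases i <;> simp [mul] <;> fun_prop
  ext i
  have h1 : (fderiv ℝ (mul a) p v) i = fderiv ℝ (fun q => mul a q i) p v := by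
    have := ((EuclideanSpace.proj (𝕜 := ℝ) i).hasFDerivAt.comp p hd.hasFDerivAt).fderiv
    have h2 := congrArg (fun L => L v) this
    exact h2.symm
  have hp : ∀ j : Fin 3, HasFDerivAt (fun q : E2Tilde => q j)
      (EuclideanSpace.proj (𝕜 := ℝ) j : E2Tilde →L[ℝ] ℝ) p := fun j =>
    (EuclideanSpace.proj (𝕜 := ℝ) j : E2Tilde →L[ℝ] ℝ).hasFDerivAt
  rw [h1]
  fin_cases i
  · have := ((((hp 0).mul_const (Real.cos (a 2))).const_add (a 0)).sub
      ((hp 1).mul_const (Real.sin (a 2)))).fderiv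
    have h2 := congrArg (fun L => L v) this
    refine h2.trans ?_
    simp [mul_comm]
  · have := ((((hp 0).mul_const (Real.sin (a 2))).const_add (a 1)).add
      ((hp 1).mul_const (Real.cos (a 2)))).fderiv
    have h2 := congrArg (fun L => L v) this
    refine h2.trans ?_
    simp [mul_comm]
  · have := ((hp 2).const_add (a 2)).fderiv
    have h2 := congrArg (fun L => L v) this
    refine h2.trans ?_
    simp

/-- The metric is left-invariant. -/
theorem metric_mul_left (l₁ l₂ : ℝ) (a p v w : E2Tilde) :
    metric l₁ l₂ (mul a p) (fderiv ℝ (mul a) p v) (fderiv ℝ (mul a) p w) = metric l₁ l₂ p v w := by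
  have key : ∀ v : E2Tilde,
      Real.cos (a 2 + p 2) * (v 0 * Real.cos (a 2) - v 1 * Real.sin (a 2))
        + Real.sin (a 2 + p 2) * (v 0 * Real.sin (a 2) + v 1 * Real.cos (a 2))
        = Real.cos (p 2) * v 0 + Real.sin (p 2) * v 1 ∧
      -Real.sin (a 2 + p 2) * (v 0 * Real.cos (a 2) - v 1 * Real.sin (a 2))
        + Real.cos (a 2 + p 2) * (v 0 * Real.sin (a 2) + v 1 * Real.cos (a 2))
        = -Real.sin (p 2) * v 0 + Real.cos (p 2) * v 1 := by
    intro v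
    have h := Real.sin_sq_add_cos_sq (a 2)
    rw [Real.cos_add, Real.sin_add]
    constructor
    · linear_combination (Real.cos (p 2) * v 0 + Real.sin (p 2) * v 1) * h
    · linear_combination (-Real.sin (p 2) * v 0 + Real.cos (p 2) * v 1) * h
  rw [fderiv_mul_left, fderiv_mul_left]
  simp only [metric]
  rw [show (mul a p) 2 = a 2 + p 2 by simp [mul]]
  simp only [Matrix.cons_val]
  rw [(key v).1, (key v).2, (key w).1, (key w).2]

/-- The `i`-th coordinate vector field `∂ᵢ` of `ℝ³`. -/
def coordVec (i : Fin 3) : E2Tilde := EuclideanSpace.single i 1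

/-- The metric coefficient `g_{ij} = ⟨∂ᵢ, ∂ⱼ⟩`. -/
def metricCoeff (l₁ l₂ : ℝ) (i j : Fin 3) (p : E2Tilde) : ℝ :=
  metric l₁ l₂ p (coordVec i) (coordVec j)

/-- The Christoffel symbol of the first kind of the Levi-Civita connection,
`⟨∇_{∂ᵢ} ∂ⱼ, ∂ₖ⟩ = (∂ᵢ g_{jk} + ∂ⱼ g_{ik} - ∂ₖ g_{ij}) / 2`. -/
def christoffel (l₁ l₂ : ℝ) (i j k : Fin 3) (p : E2Tilde) : ℝ :=
  (fderiv ℝ (metricCoeff l₁ l₂ j k) p (coordVec i)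
    + fderiv ℝ (metricCoeff l₁ l₂ i k) p (coordVec j)
    - fderiv ℝ (metricCoeff l₁ l₂ i j) p (coordVec k)) / 2

/-- The coordinate tangent vector `∂ᵢF` of a parametrized surface `F`. -/
def partialD (F : Plane2 → E2Tilde) (i : Fin 2) (u : Plane2) : E2Tilde :=
  fderiv ℝ F u (EuclideanSpace.single i 1)

/-- The first fundamental form `(⟨∂ᵢF, ∂ⱼF⟩)` of `F` at `u`. -/
def firstForm (l₁ l₂ : ℝ) (F : Plane2 → E2Tilde) (u : Plane2) : Matrix (Fin 2) (Fin 2) ℝ :=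
  Matrix.of fun i j => metric l₁ l₂ (F u) (partialD F i u) (partialD F j u)

/-- The second fundamental form `(⟨∇_{∂ᵢ} ∂ⱼF, N⟩)` of `F` at `u` with respect to the vector `N`,
where `∇` is the Levi-Civita connection of the ambient metric (pulled back along `F`). -/
def secondForm (l₁ l₂ : ℝ) (F : Plane2 → E2Tilde) (u : Plane2) (N : E2Tilde) :
    Matrix (Fin 2) (Fin 2) ℝ :=
  Matrix.of fun i j =>
    metric l₁ l₂ (F u) (partialD (partialD F j) i u) N
      + ∑ a : Fin 3, ∑ b : Fin 3, ∑ c : Fin 3,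
          christoffel l₁ l₂ a b c (F u) * partialD F i u a * partialD F j u b * N c

/-- `N` is a unit normal vector of `F` at `u`. -/
def IsUnitNormal (l₁ l₂ : ℝ) (F : Plane2 → E2Tilde) (u : Plane2) (N : E2Tilde) : Prop :=
  (∀ i, metric l₁ l₂ (F u) (partialD F i u) N = 0) ∧ metric l₁ l₂ (F u) N N = 1

/-- The mean curvature of `F` at `u` with respect to the unit normal vector `N`: half the trace of
the second fundamental form with respect to the first one. -/
def meanCurvature (l₁ l₂ : ℝ) (F : Plane2 → E2Tilde) (u : Plane2) (N : E2Tilde) : ℝ :=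
  ((firstForm l₁ l₂ F u)⁻¹ * secondForm l₁ l₂ F u N).trace / 2

variable {M : Type*} [TopologicalSpace M] [ChartedSpace Plane2 M]

/-- A smooth immersion of a surface (without boundary): a smooth map with injective differential. -/
def IsSmoothImmersion (f : M → E2Tilde) : Prop :=
  ContMDiff (𝓡 2) (𝓡 3) ∞ f ∧ ∀ x, Function.Injective (mfderiv (𝓡 2) (𝓡 3) f x)

/-- The map `f` has zero mean curvature: in every smooth chart of the surface, the mean curvature
of the local parametrization vanishes for each unit normal vector. -/
def HasZeroMeanCurvature (l₁ l₂ : ℝ) (f : M → E2Tilde) : Prop :=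
  ∀ e ∈ IsManifold.maximalAtlas (𝓡 2) ∞ M, ∀ u ∈ e.target, ∀ N : E2Tilde,
    IsUnitNormal l₁ l₂ (f ∘ e.symm) u N → meanCurvature l₁ l₂ (f ∘ e.symm) u N = 0

/-- A properly immersed minimal surface. -/
structure IsProperMinimalImmersion (l₁ l₂ : ℝ) (f : M → E2Tilde) : Prop where
  immersion : IsSmoothImmersion f
  proper : IsProperMap f
  minimal : HasZeroMeanCurvature l₁ l₂ f

/-- The plane `{x₃ = b}`. -/
def horizontalPlane (b : ℝ) : Set E2Tilde := {p | p 2 = b}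

end E2Tilde

end

/-!
The proof is a comparison argument with explicit functions on the ambient group. If `G ∘ f` has a
local minimum at a point of a minimal surface `f`, then the trace of the Riemannian Hessian of `G`
on the tangent plane there is nonnegative (`exists_covHess_add_nonneg`), because the gradient of `G`
is normal and the mean curvature vanishes. So a function whose Hessian has negative trace on every
plane has no local minimum on a minimal surface.

Such functions are `-exp (-K z) + t log (ℓ + log s)` with small `t > 0` (`barrier`). Here `z` is the
height (or its negative) and `s` the squared distance to a vertical line within horizontal planes,
for the induced flat metric. On a plane with unit normal `n`, let `h² = n₀² + n₁²`, which vanishes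
for horizontal planes. Horizontal planes are minimal, but not totally geodesic if `l₁ ≠ l₂`; the
trace of the Hessian of `z` is `O(h²)`, and for large `K` that of `-exp (-K z)` is at most a
negative multiple of `h²` (`height_trace_le`). The double logarithm is strictly superharmonic on
horizontal planes, with Laplacian `-|∇ log (ℓ + log s)|²`, and by Young's inequality this absorbs
the terms of first order in `h` (`loglog_trace_le`); the terms of second order are dominated by the
height part.

The barrier is used twice. First, the height attains its infimum (`exists_forall_height_le`):
otherwise, by properness, the part of the surface just above the infimum avoids a vertical cylinder,
and there the barrier tends to infinity, hence has a minimum; for small `t` this minimum is not on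
the upper boundary. Secondly, a surface that touches a horizontal plane from one side lies in it
(`height_eq_of_le`): the set of contact points is closed, and around a point of its boundary the
surface is a graph, so that one finds an elliptic annulus which contains a contact point, but none
on its inner boundary; for small `t` the barrier would have an interior minimum there.

Finally, a properly immersed surface contained in a horizontal plane projects to the
`(x₁, x₂)`-plane by a proper local homeomorphism. This is a covering map of a simply connected
space, hence bijective.
-/

open Set Filter Topology

/-! ### Proper local homeomorphisms onto simply connected spaces -/

/-- A proper local homeomorphism from a nonempty connected Hausdorff space to a simply connected,
locally path-connected space is bijective: it is a covering map, hence has a section through any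
point, and the section is a two-sided inverse by uniqueness of lifts. -/
theorem IsLocalHomeomorph.bijective_of_isProperMap {X Y : Type*} [TopologicalSpace X]
    [TopologicalSpace Y] [T2Space X] [ConnectedSpace X] [SimplyConnectedSpace Y]
    [LocallyPathConnectedSpace Y] {p : X → Y} (hp : IsLocalHomeomorph p) (hprop : IsProperMap p) :
    Function.Bijective p := by
  have hfin : ∀ y, (p ⁻¹' {y}).Finite := by
    intro y
    have hc : IsCompact (p ⁻¹' {y}) := hprop.isCompact_preimage isCompact_singleton
    refine hc.finite (IsDiscrete.of_openPartialHomeomorph p (x := y) subset_rfl fun e _ => ?_)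
    obtain ⟨φ, hφ, h⟩ := hp e
    exact ⟨φ, hφ, h.symm⟩
  have hcov : IsCoveringMap p := isCoveringMap_iff_isCoveringMapOn_univ.2
    (hprop.isClosedMap.isCoveringMapOn_of_isLocalHomeomorphOn (fun y _ => hfin y)
      hp.isLocalHomeomorphOn)
  obtain ⟨x₀⟩ : Nonempty X := inferInstance
  obtain ⟨F, ⟨hF0, hF⟩, -⟩ :=
    hcov.existsUnique_continuousMap_lifts (ContinuousMap.id Y) (p x₀) x₀ rfl
  have hright : ∀ y, p (F y) = y := fun y => congrFun hF y
  have hleft : F ∘ p = id := hcov.eq_of_comp_eq (F.continuous.comp hprop.continuous) continuous_id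
    (by ext x; exact hright (p x)) x₀ hF0
  have hinv : Function.LeftInverse F p := fun x => congrFun hleft x
  exact ⟨hinv.injective, Function.RightInverse.surjective hright⟩

/-! ### Second derivatives along lines, chain rule, and second order conditions -/

section SecondDerivative

variable {E F : Type*} [NormedAddCommGroup E] [NormedSpace ℝ E]
  [NormedAddCommGroup F] [NormedSpace ℝ F]

theorem ContDiffAt.differentiableAt_fderiv {f : E → F} {x : E} (hf : ContDiffAt ℝ 2 f x) :
    DifferentiableAt ℝ (fderiv ℝ f) x :=
  (hf.fderiv_right (m := 1) (by norm_num)).differentiableAt (by norm_num)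

theorem ContDiffAt.eventually_differentiableAt {f : E → F} {x : E} (hf : ContDiffAt ℝ 2 f x) :
    ∀ᶠ y in 𝓝 x, DifferentiableAt ℝ f y :=
  (hf.eventually (by norm_num)).mono fun _ h => h.differentiableAt (by norm_num)

/-- The second order chain rule, on the diagonal. -/
theorem fderiv_fderiv_comp {H : Type*} [NormedAddCommGroup H] [NormedSpace ℝ H]
    {g : F → H} {f : E → F} {x : E} (hg : ContDiffAt ℝ 2 g (f x)) (hf : ContDiffAt ℝ 2 f x)
    (v : E) :
    fderiv ℝ (fderiv ℝ (g ∘ f)) x v v =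
      fderiv ℝ (fderiv ℝ g) (f x) (fderiv ℝ f x v) (fderiv ℝ f x v)
        + fderiv ℝ g (f x) (fderiv ℝ (fderiv ℝ f) x v v) := by
  have hfd : DifferentiableAt ℝ f x := hf.differentiableAt (by norm_num)
  have h1 : fderiv ℝ (g ∘ f) =ᶠ[𝓝 x] fun y => (fderiv ℝ g (f y)).comp (fderiv ℝ f y) := by
    filter_upwards [hf.eventually_differentiableAt,
      hfd.continuousAt.eventually hg.eventually_differentiableAt] with y hy1 hy2
    exact fderiv_comp y hy2 hy1
  have h2 : HasFDerivAt (fun y => fderiv ℝ g (f y))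
      ((fderiv ℝ (fderiv ℝ g) (f x)).comp (fderiv ℝ f x)) x :=
    hg.differentiableAt_fderiv.hasFDerivAt.comp x hfd.hasFDerivAt
  have h3 := h2.clm_comp hf.differentiableAt_fderiv.hasFDerivAt
  rw [h1.fderiv_eq, h3.fderiv]
  simp [add_comm]

theorem hasDerivAt_line (x v : E) (τ : ℝ) : HasDerivAt (fun τ : ℝ => x + τ • v) v τ := by
  simpa using ((hasDerivAt_id τ).smul_const v).const_add x

theorem tendsto_line (x v : E) : Tendsto (fun τ : ℝ => x + τ • v) (𝓝 0) (𝓝 x) := by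
  simpa using (hasDerivAt_line x v 0).continuousAt.tendsto

theorem hasDerivAt_fderiv_line {f : E → ℝ} {x : E} (hf : ContDiffAt ℝ 2 f x) (v : E) :
    HasDerivAt (fun τ : ℝ => fderiv ℝ f (x + τ • v) v) (fderiv ℝ (fderiv ℝ f) x v v) 0 := by
  have h5 : HasFDerivAt (fderiv ℝ f) (fderiv ℝ (fderiv ℝ f) x) (x + (0 : ℝ) • v) := by
    simpa using hf.differentiableAt_fderiv.hasFDerivAt
  have h6 : HasDerivAt (fun τ : ℝ => fderiv ℝ f (x + τ • v)) (fderiv ℝ (fderiv ℝ f) x v) 0 :=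
    h5.comp_hasDerivAt (0 : ℝ) (hasDerivAt_line x v 0)
  exact (ContinuousLinearMap.apply ℝ ℝ v).hasFDerivAt.comp_hasDerivAt (0 : ℝ) h6

/-- The second derivative in a direction can be computed along a line. -/
theorem fderiv_fderiv_eq_of_hasDerivAt {f : E → ℝ} {x v : E} (hf : ContDiffAt ℝ 2 f x)
    {g' : ℝ → ℝ} {c : ℝ} (h1 : ∀ᶠ τ in 𝓝 (0 : ℝ), HasDerivAt (fun τ => f (x + τ • v)) (g' τ) τ)
    (h2 : HasDerivAt g' c 0) : fderiv ℝ (fderiv ℝ f) x v v = c := by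
  have hl := hasDerivAt_line x v
  have hl0 := tendsto_line x v
  have h3 : g' =ᶠ[𝓝 0] fun τ => fderiv ℝ f (x + τ • v) v := by
    filter_upwards [h1, hl0.eventually hf.eventually_differentiableAt] with τ h h'
    exact h.unique (h'.hasFDerivAt.comp_hasDerivAt τ (hl τ))
  have h4 := hasDerivAt_fderiv_line hf v
  exact h4.unique (h2.congr_of_eventuallyEq h3.symm)

/-- The second order necessary condition at a local minimum, on the real line. -/
theorem IsLocalMin.deriv_deriv_nonneg {f : ℝ → ℝ} {x : ℝ} (h : IsLocalMin f x)
    (hc : ContinuousAt f x) : 0 ≤ deriv (deriv f) x := by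
  by_contra! hneg
  -- By the second derivative test `-f` has a local minimum too, so `f` is locally constant.
  have h1 : IsLocalMin (fun y => -f y) x := by
    refine isLocalMin_of_deriv_deriv_pos ?_ ?_ hc.neg
    · have : deriv (fun y => -f y) = fun y => -deriv f y := by ext y; exact deriv.fun_neg
      rw [this, deriv.fun_neg]; linarith
    · rw [deriv.fun_neg, h.deriv_eq_zero, neg_zero]
  have h2 : f =ᶠ[𝓝 x] fun _ => f x := by
    filter_upwards [h, h1] with y hy1 hy2
    linarith
  have h3 : deriv f =ᶠ[𝓝 x] fun _ => 0 := by
    simpa using h2.deriv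
  rw [h3.deriv_eq] at hneg
  simp at hneg

/-- The second order necessary condition at a local minimum. -/
theorem IsLocalMin.fderiv_fderiv_nonneg {f : E → ℝ} {x : E} (h : IsLocalMin f x)
    (hf : ContDiffAt ℝ 2 f x) (v : E) : 0 ≤ fderiv ℝ (fderiv ℝ f) x v v := by
  have hl := hasDerivAt_line x v
  have hl0 := tendsto_line x v
  have hmin : IsLocalMin (fun τ : ℝ => f (x + τ • v)) 0 := by
    filter_upwards [hl0.eventually h] with τ hτ
    simpa using hτ
  have hc : ContinuousAt (fun τ : ℝ => f (x + τ • v)) 0 := by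
    refine ContinuousAt.comp (g := f) ?_ (hl 0).continuousAt
    simpa using hf.continuousAt
  have h1 : deriv (fun τ : ℝ => f (x + τ • v)) =ᶠ[𝓝 0] fun τ => fderiv ℝ f (x + τ • v) v := by
    filter_upwards [hl0.eventually hf.eventually_differentiableAt] with τ h'
    exact (h'.hasFDerivAt.comp_hasDerivAt τ (hl τ)).deriv
  have h4 := hasDerivAt_fderiv_line hf v
  have := hmin.deriv_deriv_nonneg hc
  rwa [h1.deriv_eq, h4.deriv] at this

end SecondDerivative

/-! ### The left-invariant frame and the Christoffel symbols -/

namespace E2Tilde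

/-- The components of the tangent vector `v` at `p` in the left-invariant orthonormal frame. -/
noncomputable def coframe (l₁ l₂ : ℝ) (p v : E2Tilde) : Fin 3 → ℝ :=
  ![l₁ * (Real.cos (p 2) * v 0 + Real.sin (p 2) * v 1),
    l₂ * (-Real.sin (p 2) * v 0 + Real.cos (p 2) * v 1),
    v 2 / (l₁ * l₂)]

/-- The tangent vector at `p` with components `a` in the left-invariant orthonormal frame. -/
noncomputable def ofFrame (l₁ l₂ : ℝ) (p : E2Tilde) (a : Fin 3 → ℝ) : E2Tilde :=
  !₂[Real.cos (p 2) * (a 0 / l₁) - Real.sin (p 2) * (a 1 / l₂),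
     Real.sin (p 2) * (a 0 / l₁) + Real.cos (p 2) * (a 1 / l₂),
     l₁ * l₂ * a 2]

section Frame

variable {l₁ l₂ : ℝ}

theorem coframe_add (p v w : E2Tilde) :
    coframe l₁ l₂ p (v + w) = coframe l₁ l₂ p v + coframe l₁ l₂ p w := by
  ext i; fin_cases i <;> simp [coframe] <;> ring

theorem coframe_smul (p : E2Tilde) (r : ℝ) (v : E2Tilde) :
    coframe l₁ l₂ p (r • v) = r • coframe l₁ l₂ p v := by
  ext i; fin_cases i <;> simp [coframe] <;> ring

theorem coframe_ofFrame (h₁ : l₁ ≠ 0) (h₂ : l₂ ≠ 0) (p : E2Tilde) (a : Fin 3 → ℝ) :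
    coframe l₁ l₂ p (ofFrame l₁ l₂ p a) = a := by
  have h := Real.sin_sq_add_cos_sq (p 2)
  ext i
  fin_cases i <;> simp [coframe, ofFrame]
  · field_simp
    linear_combination (a 0 * l₂) * h
  · field_simp
    linear_combination (a 1 * l₁) * h
  · field_simp

theorem ofFrame_coframe (h₁ : l₁ ≠ 0) (h₂ : l₂ ≠ 0) (p v : E2Tilde) :
    ofFrame l₁ l₂ p (coframe l₁ l₂ p v) = v := by
  have h := Real.sin_sq_add_cos_sq (p 2)
  ext i
  fin_cases i <;> simp [coframe, ofFrame]
  · field_simp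
    linear_combination (v 0) * h
  · field_simp
    linear_combination (v 1) * h
  · field_simp

theorem metric_eq_coframe (p v w : E2Tilde) :
    metric l₁ l₂ p v w = coframe l₁ l₂ p v 0 * coframe l₁ l₂ p w 0
      + coframe l₁ l₂ p v 1 * coframe l₁ l₂ p w 1
      + coframe l₁ l₂ p v 2 * coframe l₁ l₂ p w 2 := by
  simp [coframe, metric]; ring

theorem eq_zero_of_metric_self (h₁ : l₁ ≠ 0) (h₂ : l₂ ≠ 0) {p v : E2Tilde}
    (h : metric l₁ l₂ p v v = 0) : v = 0 := by
  rw [metric_eq_coframe] at h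
  have q0 := mul_self_nonneg (coframe l₁ l₂ p v 0)
  have q1 := mul_self_nonneg (coframe l₁ l₂ p v 1)
  have q2 := mul_self_nonneg (coframe l₁ l₂ p v 2)
  have h0 : coframe l₁ l₂ p v 0 = 0 := mul_self_eq_zero.1 (by linarith)
  have h1 : coframe l₁ l₂ p v 1 = 0 := mul_self_eq_zero.1 (by linarith)
  have h2 : coframe l₁ l₂ p v 2 = 0 := mul_self_eq_zero.1 (by linarith)
  rw [← ofFrame_coframe h₁ h₂ p v]
  ext i; fin_cases i <;> simp [ofFrame, h0, h1, h2]

theorem fderiv_metricCoeff (i j : Fin 3) (p u : E2Tilde) :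
    fderiv ℝ (metricCoeff l₁ l₂ i j) p u = u 2 * (l₁ ^ 2 - l₂ ^ 2) *
      ((Real.cos (p 2) * coordVec i 0 + Real.sin (p 2) * coordVec i 1)
          * (-Real.sin (p 2) * coordVec j 0 + Real.cos (p 2) * coordVec j 1)
        + (-Real.sin (p 2) * coordVec i 0 + Real.cos (p 2) * coordVec i 1)
          * (Real.cos (p 2) * coordVec j 0 + Real.sin (p 2) * coordVec j 1)) := by
  have hp : HasFDerivAt (fun q : E2Tilde => q 2)
      (EuclideanSpace.proj (𝕜 := ℝ) (2 : Fin 3) : E2Tilde →L[ℝ] ℝ) p :=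
    (EuclideanSpace.proj (𝕜 := ℝ) (2 : Fin 3) : E2Tilde →L[ℝ] ℝ).hasFDerivAt
  set m : ℝ → ℝ := fun z => l₁ ^ 2 * (Real.cos z * coordVec i 0 + Real.sin z * coordVec i 1)
      * (Real.cos z * coordVec j 0 + Real.sin z * coordVec j 1)
    + l₂ ^ 2 * (-Real.sin z * coordVec i 0 + Real.cos z * coordVec i 1)
      * (-Real.sin z * coordVec j 0 + Real.cos z * coordVec j 1)
    + 1 / (l₁ ^ 2 * l₂ ^ 2) * (coordVec i 2 * coordVec j 2) with hm
  have hα : ∀ k : Fin 3, HasDerivAt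
      (fun z => Real.cos z * coordVec k 0 + Real.sin z * coordVec k 1)
      (-Real.sin (p 2) * coordVec k 0 + Real.cos (p 2) * coordVec k 1) (p 2) := fun k =>
    ((Real.hasDerivAt_cos _).mul_const _).add ((Real.hasDerivAt_sin _).mul_const _)
  have hβ : ∀ k : Fin 3, HasDerivAt
      (fun z => -Real.sin z * coordVec k 0 + Real.cos z * coordVec k 1)
      (-Real.cos (p 2) * coordVec k 0 + -Real.sin (p 2) * coordVec k 1) (p 2) := fun k =>
    ((Real.hasDerivAt_sin _).neg.mul_const _).add ((Real.hasDerivAt_cos _).mul_const _)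
  have h1 := ((((hα i).const_mul (l₁ ^ 2)).mul (hα j)).add
    (((hβ i).const_mul (l₂ ^ 2)).mul (hβ j))).add_const
      (1 / (l₁ ^ 2 * l₂ ^ 2) * (coordVec i 2 * coordVec j 2))
  have h2 := congrArg (fun L : E2Tilde →L[ℝ] ℝ => L u) (h1.comp_hasFDerivAt p hp).fderiv
  refine Eq.trans ?_ (h2.trans ?_)
  · rfl
  · simp
    ring

/-- The trilinear form `⟨Γ(v, w), n⟩` of the Christoffel symbols, in frame components. It vanishes
if `l₁ = l₂`, where the metric is flat and the coordinates are affine. -/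
theorem sum_christoffel (h₁ : l₁ ≠ 0) (h₂ : l₂ ≠ 0) (p v w n : E2Tilde) :
    ∑ a : Fin 3, ∑ b : Fin 3, ∑ c : Fin 3,
        christoffel l₁ l₂ a b c p * v a * w b * n c =
      (l₁ ^ 2 - l₂ ^ 2) / 2 *
        ((coframe l₁ l₂ p v 1 * coframe l₁ l₂ p w 2 + coframe l₁ l₂ p v 2 * coframe l₁ l₂ p w 1)
            * coframe l₁ l₂ p n 0
          + (coframe l₁ l₂ p v 0 * coframe l₁ l₂ p w 2 + coframe l₁ l₂ p v 2 * coframe l₁ l₂ p w 0)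
            * coframe l₁ l₂ p n 1
          - (coframe l₁ l₂ p v 0 * coframe l₁ l₂ p w 1 + coframe l₁ l₂ p v 1 * coframe l₁ l₂ p w 0)
            * coframe l₁ l₂ p n 2) := by
  simp only [christoffel, fderiv_metricCoeff, Fin.sum_univ_three, coframe]
  simp [coordVec]
  field_simp
  ring

end Frame

end E2Tilde

/-! ### The Hessian at an interior minimum on a minimal surface -/

namespace E2Tilde

/-- The vector `Γ(v, v)`, by which the covariant acceleration of a curve with velocity `v` at `p`
exceeds its coordinate acceleration. -/
noncomputable def christoffelVec (l₁ l₂ : ℝ) (p v : E2Tilde) : E2Tilde :=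
  ofFrame l₁ l₂ p
    ![(l₁ ^ 2 - l₂ ^ 2) * (coframe l₁ l₂ p v 1 * coframe l₁ l₂ p v 2),
      (l₁ ^ 2 - l₂ ^ 2) * (coframe l₁ l₂ p v 0 * coframe l₁ l₂ p v 2),
      -((l₁ ^ 2 - l₂ ^ 2) * (coframe l₁ l₂ p v 0 * coframe l₁ l₂ p v 1))]

/-- The Riemannian Hessian of `G` at `p`, as a quadratic form. -/
noncomputable def covHess (l₁ l₂ : ℝ) (G : E2Tilde → ℝ) (p v : E2Tilde) : ℝ :=
  fderiv ℝ (fderiv ℝ G) p v v - fderiv ℝ G p (christoffelVec l₁ l₂ p v)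

variable {l₁ l₂ : ℝ}

theorem partialD_partialD {F : Plane2 → E2Tilde} {u : Plane2} (hF : ContDiffAt ℝ 2 F u)
    (i j : Fin 2) :
    partialD (partialD F j) i u =
      fderiv ℝ (fderiv ℝ F) u (EuclideanSpace.single i 1) (EuclideanSpace.single j 1) := by
  have h := (ContinuousLinearMap.apply ℝ E2Tilde
    (EuclideanSpace.single j (1 : ℝ) : Plane2)).hasFDerivAt.comp u
      hF.differentiableAt_fderiv.hasFDerivAt
  exact congrArg (fun L => L (EuclideanSpace.single i 1)) h.fderiv

theorem clm_eq_sum_coframe (h₁ : l₁ ≠ 0) (h₂ : l₂ ≠ 0) (p : E2Tilde) (L : E2Tilde →L[ℝ] ℝ) :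
    ∃ q : Fin 3 → ℝ, ∀ v, L v = q 0 * coframe l₁ l₂ p v 0 + q 1 * coframe l₁ l₂ p v 1
      + q 2 * coframe l₁ l₂ p v 2 := by
  refine ⟨fun i => L (ofFrame l₁ l₂ p (Pi.single i 1)), fun v => ?_⟩
  have : v = coframe l₁ l₂ p v 0 • ofFrame l₁ l₂ p (Pi.single 0 1)
      + coframe l₁ l₂ p v 1 • ofFrame l₁ l₂ p (Pi.single 1 1)
      + coframe l₁ l₂ p v 2 • ofFrame l₁ l₂ p (Pi.single 2 1) := by
    conv_lhs => rw [← ofFrame_coframe h₁ h₂ p v]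
    ext i; fin_cases i <;> simp [ofFrame] <;> ring
  conv_lhs => rw [this]
  simp only [map_add, map_smul, smul_eq_mul]
  ring

/-- The vanishing of the mean curvature, without the inverse of the first fundamental form. -/
theorem adjugate_trace_eq_zero {F : Plane2 → E2Tilde} {u : Plane2} {N : E2Tilde}
    (hdet : (firstForm l₁ l₂ F u).det ≠ 0) (h : meanCurvature l₁ l₂ F u N = 0) :
    firstForm l₁ l₂ F u 1 1 * secondForm l₁ l₂ F u N 0 0
      - firstForm l₁ l₂ F u 0 1 * secondForm l₁ l₂ F u N 1 0
      - firstForm l₁ l₂ F u 1 0 * secondForm l₁ l₂ F u N 0 1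
      + firstForm l₁ l₂ F u 0 0 * secondForm l₁ l₂ F u N 1 1 = 0 := by
  unfold meanCurvature at h
  rw [Matrix.inv_def, Matrix.smul_mul, Matrix.trace_smul, Ring.inverse_eq_inv', smul_eq_mul] at h
  have h' : ((firstForm l₁ l₂ F u).adjugate * secondForm l₁ l₂ F u N).trace = 0 := by
    rcases mul_eq_zero.1 (div_eq_zero_iff.1 h |>.resolve_right two_ne_zero) with h | h
    · exact absurd h (inv_ne_zero hdet)
    · exact h
  rw [Matrix.adjugate_fin_two, Matrix.trace_fin_two, Matrix.mul_apply, Matrix.mul_apply,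
    Fin.sum_univ_two, Fin.sum_univ_two] at h'
  simp at h'
  linarith

theorem secondForm_eq (h₁ : l₁ ≠ 0) (h₂ : l₂ ≠ 0) {F : Plane2 → E2Tilde} {u : Plane2}
    (hF : ContDiffAt ℝ 2 F u) (N : E2Tilde) (i j : Fin 2) :
    secondForm l₁ l₂ F u N i j =
      metric l₁ l₂ (F u) (fderiv ℝ (fderiv ℝ F) u (EuclideanSpace.single i 1)
          (EuclideanSpace.single j 1)) N
        + (l₁ ^ 2 - l₂ ^ 2) / 2 *
          ((coframe l₁ l₂ (F u) (partialD F i u) 1 * coframe l₁ l₂ (F u) (partialD F j u) 2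
              + coframe l₁ l₂ (F u) (partialD F i u) 2 * coframe l₁ l₂ (F u) (partialD F j u) 1)
                * coframe l₁ l₂ (F u) N 0
            + (coframe l₁ l₂ (F u) (partialD F i u) 0 * coframe l₁ l₂ (F u) (partialD F j u) 2
              + coframe l₁ l₂ (F u) (partialD F i u) 2 * coframe l₁ l₂ (F u) (partialD F j u) 0)
                * coframe l₁ l₂ (F u) N 1
            - (coframe l₁ l₂ (F u) (partialD F i u) 0 * coframe l₁ l₂ (F u) (partialD F j u) 1
              + coframe l₁ l₂ (F u) (partialD F i u) 1 * coframe l₁ l₂ (F u) (partialD F j u) 0)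
                * coframe l₁ l₂ (F u) N 2) := by
  rw [← sum_christoffel h₁ h₂, ← partialD_partialD hF]
  rfl

/-- The algebra behind `exists_covHess_add_nonneg`, in components. The vectors `k`, `m`, `n`, `o`
are the second partial derivatives of the parametrization, `c` is the cross product of the
coordinate tangent vectors `a`, `b`, and `μ c` is the gradient of the function; `S` is the second fundamental
form with respect to `c / s`. The terms `μ ⟨c, ·⟩` of the two second derivatives combine to a
multiple of the mean curvature and the correction that turns them into Hessians. -/
theorem hess_add_nonneg_of_trace_secondForm_eq_zero {δ a₀ a₁ a₂ b₀ b₁ b₂ c₀ c₁ c₂ g₁₁ g₁₂ g₂₂ s μ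
    q₁ q₂ S₀₀ S₀₁ S₁₀ S₁₁ k₀ k₁ k₂ m₀ m₁ m₂ n₀ n₁ n₂ o₀ o₁ o₂ : ℝ}
    (hXX : 0 ≤ q₁ + (g₂₂ * g₂₂ * (μ * (c₀ * k₀ + c₁ * k₁ + c₂ * k₂))
      + -(g₂₂ * g₁₂) * (μ * (c₀ * m₀ + c₁ * m₁ + c₂ * m₂))
      + -(g₂₂ * g₁₂) * (μ * (c₀ * n₀ + c₁ * n₁ + c₂ * n₂))
      + g₁₂ * g₁₂ * (μ * (c₀ * o₀ + c₁ * o₁ + c₂ * o₂))))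
    (hYY : 0 ≤ q₂ + s * s * (μ * (c₀ * o₀ + c₁ * o₁ + c₂ * o₂)))
    (hss : s * s = g₁₁ * g₂₂ - g₁₂ * g₁₂)
    (hH : g₂₂ * S₀₀ - g₁₂ * S₁₀ - g₁₂ * S₀₁ + g₁₁ * S₁₁ = 0)
    (h00 : s * S₀₀ = c₀ * k₀ + c₁ * k₁ + c₂ * k₂ + δ / 2 *
      ((a₁ * a₂ + a₂ * a₁) * c₀ + (a₀ * a₂ + a₂ * a₀) * c₁ - (a₀ * a₁ + a₁ * a₀) * c₂))
    (h01 : s * S₀₁ = c₀ * m₀ + c₁ * m₁ + c₂ * m₂ + δ / 2 *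
      ((a₁ * b₂ + a₂ * b₁) * c₀ + (a₀ * b₂ + a₂ * b₀) * c₁ - (a₀ * b₁ + a₁ * b₀) * c₂))
    (h10 : s * S₁₀ = c₀ * n₀ + c₁ * n₁ + c₂ * n₂ + δ / 2 *
      ((b₁ * a₂ + b₂ * a₁) * c₀ + (b₀ * a₂ + b₂ * a₀) * c₁ - (b₀ * a₁ + b₁ * a₀) * c₂))
    (h11 : s * S₁₁ = c₀ * o₀ + c₁ * o₁ + c₂ * o₂ + δ / 2 *
      ((b₁ * b₂ + b₂ * b₁) * c₀ + (b₀ * b₂ + b₂ * b₀) * c₁ - (b₀ * b₁ + b₁ * b₀) * c₂)) :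
    0 ≤ q₁ - μ * (c₀ * (δ * ((g₂₂ * a₁ - g₁₂ * b₁) * (g₂₂ * a₂ - g₁₂ * b₂)))
        + c₁ * (δ * ((g₂₂ * a₀ - g₁₂ * b₀) * (g₂₂ * a₂ - g₁₂ * b₂)))
        + c₂ * -(δ * ((g₂₂ * a₀ - g₁₂ * b₀) * (g₂₂ * a₁ - g₁₂ * b₁))))
      + (q₂ - μ * (c₀ * (δ * (s * b₁ * (s * b₂))) + c₁ * (δ * (s * b₀ * (s * b₂)))
        + c₂ * -(δ * (s * b₀ * (s * b₁))))) := by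
  have e := congrArg (fun t => μ * g₂₂ * s * t) hH
  simp only [mul_zero] at e
  linear_combination hXX + hYY + e - μ * g₂₂ * (g₂₂ * h00 - g₁₂ * h10 - g₁₂ * h01 + g₁₁ * h11)
    + (μ * ((o₀ * c₀ + o₁ * c₁ + o₂ * c₂)
      + δ * (b₁ * b₂ * c₀ + b₀ * b₂ * c₁ - b₀ * b₁ * c₂))) * hss

set_option maxHeartbeats 1000000 in
/-- At an interior minimum of `G` on a minimal surface, the trace of the Hessian of `G` on the
tangent plane is nonnegative. The trace is taken over an orthogonal basis `X`, `Y` of tangent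
vectors of equal length. -/
theorem exists_covHess_add_nonneg (h₁ : 0 < l₁) (h₂ : 0 < l₂) {F : Plane2 → E2Tilde} {u : Plane2}
    (hF : ContDiffAt ℝ 2 F u) (hinj : Function.Injective (fderiv ℝ F u))
    (hmin : ∀ N, IsUnitNormal l₁ l₂ F u N → meanCurvature l₁ l₂ F u N = 0)
    {G : E2Tilde → ℝ} (hG : ContDiffAt ℝ 2 G (F u)) (hloc : IsLocalMin (G ∘ F) u) :
    ∃ X Y : E2Tilde, 0 < metric l₁ l₂ (F u) X X ∧
      metric l₁ l₂ (F u) Y Y = metric l₁ l₂ (F u) X X ∧ metric l₁ l₂ (F u) X Y = 0 ∧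
      0 ≤ covHess l₁ l₂ G (F u) X + covHess l₁ l₂ G (F u) Y := by
  set p := F u with hp
  obtain ⟨e₀, he₀⟩ : ∃ t : Plane2, t = EuclideanSpace.single 0 1 := ⟨_, rfl⟩
  obtain ⟨e₁, he₁⟩ : ∃ t : Plane2, t = EuclideanSpace.single 1 1 := ⟨_, rfl⟩
  obtain ⟨A, hA⟩ : ∃ t, partialD F 0 u = t := ⟨_, rfl⟩
  obtain ⟨B, hB⟩ : ∃ t, partialD F 1 u = t := ⟨_, rfl⟩
  have hA' : fderiv ℝ F u e₀ = A := by rw [he₀, ← hA]; rfl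
  have hB' : fderiv ℝ F u e₁ = B := by rw [he₁, ← hB]; rfl
  obtain ⟨a₀, ha₀⟩ : ∃ t, coframe l₁ l₂ p A 0 = t := ⟨_, rfl⟩
  obtain ⟨a₁, ha₁⟩ : ∃ t, coframe l₁ l₂ p A 1 = t := ⟨_, rfl⟩
  obtain ⟨a₂, ha₂⟩ : ∃ t, coframe l₁ l₂ p A 2 = t := ⟨_, rfl⟩
  obtain ⟨b₀, hb₀⟩ : ∃ t, coframe l₁ l₂ p B 0 = t := ⟨_, rfl⟩
  obtain ⟨b₁, hb₁⟩ : ∃ t, coframe l₁ l₂ p B 1 = t := ⟨_, rfl⟩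
  obtain ⟨b₂, hb₂⟩ : ∃ t, coframe l₁ l₂ p B 2 = t := ⟨_, rfl⟩
  obtain ⟨g₁₁, hg₁₁⟩ : ∃ t, t = a₀ * a₀ + a₁ * a₁ + a₂ * a₂ := ⟨_, rfl⟩
  obtain ⟨g₁₂, hg₁₂⟩ : ∃ t, t = a₀ * b₀ + a₁ * b₁ + a₂ * b₂ := ⟨_, rfl⟩
  obtain ⟨g₂₂, hg₂₂⟩ : ∃ t, t = b₀ * b₀ + b₁ * b₁ + b₂ * b₂ := ⟨_, rfl⟩
  obtain ⟨d, hd⟩ : ∃ t, t = g₁₁ * g₂₂ - g₁₂ * g₁₂ := ⟨_, rfl⟩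
  -- the components of the cross product of `A` and `B`
  obtain ⟨c₀, hc₀⟩ : ∃ t, t = a₁ * b₂ - a₂ * b₁ := ⟨_, rfl⟩
  obtain ⟨c₁, hc₁⟩ : ∃ t, t = a₂ * b₀ - a₀ * b₂ := ⟨_, rfl⟩
  obtain ⟨c₂, hc₂⟩ : ∃ t, t = a₀ * b₁ - a₁ * b₀ := ⟨_, rfl⟩
  have hdc : d = c₀ * c₀ + c₁ * c₁ + c₂ * c₂ := by
    rw [hd, hg₁₁, hg₁₂, hg₂₂, hc₀, hc₁, hc₂]; ring
  have mAA : metric l₁ l₂ p A A = g₁₁ := by rw [metric_eq_coframe, ha₀, ha₁, ha₂, hg₁₁]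
  have mAB : metric l₁ l₂ p A B = g₁₂ := by
    rw [metric_eq_coframe, ha₀, ha₁, ha₂, hb₀, hb₁, hb₂, hg₁₂]
  have mBA : metric l₁ l₂ p B A = g₁₂ := by
    rw [metric_eq_coframe, ha₀, ha₁, ha₂, hb₀, hb₁, hb₂, hg₁₂]; ring
  have mBB : metric l₁ l₂ p B B = g₂₂ := by rw [metric_eq_coframe, hb₀, hb₁, hb₂, hg₂₂]
  have hBne : B ≠ 0 := by
    intro h
    have h0 : e₁ = 0 := hinj (by rw [hB', h, map_zero])
    have := congrArg (fun v : Plane2 => v 1) h0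
    simp [he₁] at this
  have hg₂₂pos : 0 < g₂₂ := by
    have h0 : g₂₂ ≠ 0 := fun h => hBne (eq_zero_of_metric_self h₁.ne' h₂.ne' (mBB.trans h))
    have : 0 ≤ g₂₂ := by
      rw [hg₂₂]
      linarith [mul_self_nonneg b₀, mul_self_nonneg b₁, mul_self_nonneg b₂]
    exact lt_of_le_of_ne this h0.symm
  -- an orthogonal basis `X`, `Y` of the tangent plane, of equal lengths
  set X : E2Tilde := g₂₂ • A + (-g₁₂) • B with hX
  have coX : ∀ i, coframe l₁ l₂ p X i = g₂₂ * coframe l₁ l₂ p A i - g₁₂ * coframe l₁ l₂ p B i := by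
    intro i
    rw [hX, coframe_add, coframe_smul, coframe_smul]; simp; ring
  have mXX : metric l₁ l₂ p X X = g₂₂ * d := by
    rw [metric_eq_coframe, coX, coX, coX, ha₀, ha₁, ha₂, hb₀, hb₁, hb₂, hd, hg₁₁, hg₁₂, hg₂₂]; ring
  have hX' : fderiv ℝ F u (g₂₂ • e₀ + (-g₁₂) • e₁) = X := by
    rw [map_add, map_smul, map_smul, hA', hB']
  have hXne : X ≠ 0 := by
    intro h
    have h0 : g₂₂ • e₀ + (-g₁₂) • e₁ = 0 := hinj (by rw [hX', h, map_zero])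
    have := congrArg (fun v : Plane2 => v 0) h0
    simp [he₁, he₀, hg₂₂pos.ne'] at this
  have hdpos : 0 < d := by
    have h0 : d ≠ 0 := fun h =>
      hXne (eq_zero_of_metric_self h₁.ne' h₂.ne' (mXX.trans (by rw [h, mul_zero])))
    have : 0 ≤ d := by
      rw [hdc]
      linarith [mul_self_nonneg c₀, mul_self_nonneg c₁, mul_self_nonneg c₂]
    exact lt_of_le_of_ne this h0.symm
  obtain ⟨s, hs, hspos⟩ : ∃ s, s * s = d ∧ 0 < s :=
    ⟨√d, Real.mul_self_sqrt hdpos.le, Real.sqrt_pos.2 hdpos⟩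
  set Y : E2Tilde := s • B with hY
  have coY : ∀ i, coframe l₁ l₂ p Y i = s * coframe l₁ l₂ p B i := by
    intro i
    rw [hY, coframe_smul]; simp
  have hY' : fderiv ℝ F u (s • e₁) = Y := by rw [map_smul, hB']
  -- the unit normal
  set N : E2Tilde := ofFrame l₁ l₂ p ![c₀ / s, c₁ / s, c₂ / s] with hN
  have coN : coframe l₁ l₂ p N = ![c₀ / s, c₁ / s, c₂ / s] := coframe_ofFrame h₁.ne' h₂.ne' _ _
  have hNn : IsUnitNormal l₁ l₂ F u N := by
    refine ⟨fun i => ?_, ?_⟩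
    · rw [metric_eq_coframe, ← hp, coN]
      fin_cases i
      · change coframe l₁ l₂ p (partialD F 0 u) 0 * (c₀ / s)
          + coframe l₁ l₂ p (partialD F 0 u) 1 * (c₁ / s)
          + coframe l₁ l₂ p (partialD F 0 u) 2 * (c₂ / s) = 0
        rw [hA, ha₀, ha₁, ha₂, hc₀, hc₁, hc₂]; ring
      · change coframe l₁ l₂ p (partialD F 1 u) 0 * (c₀ / s)
          + coframe l₁ l₂ p (partialD F 1 u) 1 * (c₁ / s)
          + coframe l₁ l₂ p (partialD F 1 u) 2 * (c₂ / s) = 0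
        rw [hB, hb₀, hb₁, hb₂, hc₀, hc₁, hc₂]; ring
    · rw [metric_eq_coframe, ← hp, coN]
      simp
      field_simp
      linarith
  have hff : ∀ i j, firstForm l₁ l₂ F u i j =
      metric l₁ l₂ p (partialD F i u) (partialD F j u) := fun i j => rfl
  have hdet : (firstForm l₁ l₂ F u).det ≠ 0 := by
    rw [Matrix.det_fin_two, hff, hff, hff, hff, hA, hB, mAA, mAB, mBA, mBB, ← hd]
    exact hdpos.ne'
  have hH := adjugate_trace_eq_zero hdet (hmin N hNn)
  rw [hff, hff, hff, hff, hA, hB, mAA, mAB, mBA, mBB] at hH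
  have hS : ∀ i j, s * secondForm l₁ l₂ F u N i j =
      c₀ * coframe l₁ l₂ p (fderiv ℝ (fderiv ℝ F) u (EuclideanSpace.single i 1)
          (EuclideanSpace.single j 1)) 0
        + c₁ * coframe l₁ l₂ p (fderiv ℝ (fderiv ℝ F) u (EuclideanSpace.single i 1)
          (EuclideanSpace.single j 1)) 1
        + c₂ * coframe l₁ l₂ p (fderiv ℝ (fderiv ℝ F) u (EuclideanSpace.single i 1)
          (EuclideanSpace.single j 1)) 2
        + (l₁ ^ 2 - l₂ ^ 2) / 2 *
          ((coframe l₁ l₂ p (partialD F i u) 1 * coframe l₁ l₂ p (partialD F j u) 2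
              + coframe l₁ l₂ p (partialD F i u) 2 * coframe l₁ l₂ p (partialD F j u) 1) * c₀
            + (coframe l₁ l₂ p (partialD F i u) 0 * coframe l₁ l₂ p (partialD F j u) 2
              + coframe l₁ l₂ p (partialD F i u) 2 * coframe l₁ l₂ p (partialD F j u) 0) * c₁
            - (coframe l₁ l₂ p (partialD F i u) 0 * coframe l₁ l₂ p (partialD F j u) 1
              + coframe l₁ l₂ p (partialD F i u) 1 * coframe l₁ l₂ p (partialD F j u) 0) * c₂) := by
    intro i j
    rw [secondForm_eq h₁.ne' h₂.ne' hF, ← hp, metric_eq_coframe, coN]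
    simp only [Matrix.cons_val]
    field_simp
  -- second derivatives of `G ∘ F`
  obtain ⟨K₀₀, hK₀₀⟩ : ∃ t, fderiv ℝ (fderiv ℝ F) u e₀ e₀ = t := ⟨_, rfl⟩
  obtain ⟨K₀₁, hK₀₁⟩ : ∃ t, fderiv ℝ (fderiv ℝ F) u e₀ e₁ = t := ⟨_, rfl⟩
  obtain ⟨K₁₀, hK₁₀⟩ : ∃ t, fderiv ℝ (fderiv ℝ F) u e₁ e₀ = t := ⟨_, rfl⟩
  obtain ⟨K₁₁, hK₁₁⟩ : ∃ t, fderiv ℝ (fderiv ℝ F) u e₁ e₁ = t := ⟨_, rfl⟩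
  have hGF : ContDiffAt ℝ 2 (G ∘ F) u := hG.comp u hF
  have hcrit : ∀ e, fderiv ℝ G p (fderiv ℝ F u e) = 0 := by
    intro e
    have h := hloc.fderiv_eq_zero
    rw [fderiv_comp u (hG.differentiableAt (by norm_num)) (hF.differentiableAt (by norm_num))] at h
    exact congrArg (fun L => L e) h
  have hXX := hloc.fderiv_fderiv_nonneg hGF (g₂₂ • e₀ + (-g₁₂) • e₁)
  have hYY := hloc.fderiv_fderiv_nonneg hGF (s • e₁)
  rw [fderiv_fderiv_comp hG hF, hX'] at hXX
  rw [fderiv_fderiv_comp hG hF, hY'] at hYY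
  have hcA := hcrit e₀
  have hcB := hcrit e₁
  rw [hA'] at hcA
  rw [hB'] at hcB
  obtain ⟨q, hq⟩ := clm_eq_sum_coframe h₁.ne' h₂.ne' p (fderiv ℝ G p)
  rw [hq, ha₀, ha₁, ha₂] at hcA
  rw [hq, hb₀, hb₁, hb₂] at hcB
  -- the differential of `G` is a multiple of the normal covector
  obtain ⟨μ, hμ⟩ : ∃ μ, ∀ v, fderiv ℝ G p v = μ * (c₀ * coframe l₁ l₂ p v 0
      + c₁ * coframe l₁ l₂ p v 1 + c₂ * coframe l₁ l₂ p v 2) := by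
    refine ⟨(q 0 * c₀ + q 1 * c₁ + q 2 * c₂) / d, fun v => ?_⟩
    rw [hq]
    set k₀ := coframe l₁ l₂ p v 0
    set k₁ := coframe l₁ l₂ p v 1
    set k₂ := coframe l₁ l₂ p v 2
    rw [div_mul_eq_mul_div, eq_div_iff hdpos.ne', hd, hg₁₁, hg₁₂, hg₂₂, hc₀, hc₁, hc₂]
    linear_combination
      ((b₀ * b₀ + b₁ * b₁ + b₂ * b₂) * (k₀ * a₀ + k₁ * a₁ + k₂ * a₂)
        - (a₀ * b₀ + a₁ * b₁ + a₂ * b₂) * (k₀ * b₀ + k₁ * b₁ + k₂ * b₂)) * hcA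
      + ((a₀ * a₀ + a₁ * a₁ + a₂ * a₂) * (k₀ * b₀ + k₁ * b₁ + k₂ * b₂)
        - (a₀ * b₀ + a₁ * b₁ + a₂ * b₂) * (k₀ * a₀ + k₁ * a₁ + k₂ * a₂)) * hcB
  refine ⟨X, Y, ?_, ?_, ?_, ?_⟩
  · rw [mXX]; positivity
  · rw [mXX, metric_eq_coframe, coY, coY, coY, hb₀, hb₁, hb₂, ← hs, hg₂₂]; ring
  · rw [metric_eq_coframe, coX, coX, coX, coY, coY, coY, ha₀, ha₁, ha₂, hb₀, hb₁, hb₂, hg₂₂, hg₁₂]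
    ring
  · have eX : fderiv ℝ (fderiv ℝ F) u (g₂₂ • e₀ + (-g₁₂) • e₁) (g₂₂ • e₀ + (-g₁₂) • e₁) =
        (g₂₂ * g₂₂) • K₀₀ + (-(g₂₂ * g₁₂)) • K₀₁ + (-(g₂₂ * g₁₂)) • K₁₀
          + (g₁₂ * g₁₂) • K₁₁ := by
      simp only [map_add, map_smul, add_apply, smul_apply,
        smul_add, smul_smul, hK₀₀, hK₀₁, hK₁₀, hK₁₁]
      module
    have eY : fderiv ℝ (fderiv ℝ F) u (s • e₁) (s • e₁) = (s * s) • K₁₁ := by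
      simp only [map_smul, smul_apply, smul_smul, hK₁₁]
    rw [eX] at hXX
    rw [eY] at hYY
    simp only [covHess, christoffelVec]
    simp only [map_add, map_smul, smul_eq_mul] at hXX hYY
    rw [hμ (ofFrame _ _ _ _), hμ (ofFrame _ _ _ _), coframe_ofFrame h₁.ne' h₂.ne',
      coframe_ofFrame h₁.ne' h₂.ne']
    simp only [coX, coY, ha₀, ha₁, ha₂, hb₀, hb₁, hb₂, Matrix.cons_val]
    rw [hμ K₀₀, hμ K₀₁, hμ K₁₀, hμ K₁₁] at hXX
    rw [hμ K₁₁] at hYY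
    have hss : s * s = g₁₁ * g₂₂ - g₁₂ * g₁₂ := hs.trans hd
    have h00 := hS 0 0
    rw [← he₀, hK₀₀] at h00
    have h01 := hS 0 1
    rw [← he₀, ← he₁, hK₀₁] at h01
    have h10 := hS 1 0
    rw [← he₁, ← he₀, hK₁₀] at h10
    have h11 := hS 1 1
    rw [← he₁, hK₁₁] at h11
    rw [hA, ha₀, ha₁, ha₂] at h00
    rw [hA, hB, ha₀, ha₁, ha₂, hb₀, hb₁, hb₂] at h01 h10
    rw [hB, hb₀, hb₁, hb₂] at h11
    exact hess_add_nonneg_of_trace_secondForm_eq_zero hXX hYY hss hH h00 h01 h10 h11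

end E2Tilde

/-! ### The Hessians of the height and of the elliptic radius -/

namespace E2Tilde

variable {l₁ l₂ : ℝ}

section HessianCalculus

theorem covHess_add {G H : E2Tilde → ℝ} {p : E2Tilde} (hG : ContDiffAt ℝ 2 G p)
    (hH : ContDiffAt ℝ 2 H p) (v : E2Tilde) :
    covHess l₁ l₂ (fun q => G q + H q) p v = covHess l₁ l₂ G p v + covHess l₁ l₂ H p v := by
  have h1 : fderiv ℝ (fun q => G q + H q) =ᶠ[𝓝 p] fun q => fderiv ℝ G q + fderiv ℝ H q := by
    filter_upwards [hG.eventually_differentiableAt, hH.eventually_differentiableAt] with q h h'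
    exact fderiv_fun_add h h'
  rw [covHess, covHess, covHess, h1.fderiv_eq, h1.eq_of_nhds,
    fderiv_fun_add hG.differentiableAt_fderiv hH.differentiableAt_fderiv, add_apply, add_apply,
    add_apply]
  ring

theorem covHess_comp {h : E2Tilde → ℝ} {p : E2Tilde} (hh : ContDiffAt ℝ 2 h p)
    {φ φ' : ℝ → ℝ} {φ'' : ℝ} (hφ : ContDiffAt ℝ 2 φ (h p))
    (h1 : ∀ᶠ y in 𝓝 (h p), HasDerivAt φ (φ' y) y) (h2 : HasDerivAt φ' φ'' (h p)) (v : E2Tilde) :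
    covHess l₁ l₂ (fun q => φ (h q)) p v =
      φ'' * fderiv ℝ h p v ^ 2 + φ' (h p) * covHess l₁ l₂ h p v := by
  have e1 : ∀ w : ℝ, fderiv ℝ φ (h p) w = φ' (h p) * w := fun w => by
    rw [h1.self_of_nhds.hasFDerivAt.fderiv]; simp [mul_comm]
  have e2 : ∀ w : ℝ, fderiv ℝ (fderiv ℝ φ) (h p) w w = φ'' * w ^ 2 := by
    intro w
    have hl : ∀ τ : ℝ, HasDerivAt (fun τ : ℝ => h p + τ • w) w τ := hasDerivAt_line (h p) w
    refine fderiv_fderiv_eq_of_hasDerivAt (g' := fun τ => φ' (h p + τ • w) * w) hφ ?_ ?_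
    · filter_upwards [(tendsto_line (h p) w).eventually h1] with τ hτ
      exact hτ.comp τ (hl τ)
    · have h3 : HasDerivAt φ' φ'' (h p + (0 : ℝ) • w) := by simpa using h2
      refine ((h3.comp (0 : ℝ) (hl 0)).mul_const w).congr_deriv ?_
      ring
  have e3 := fderiv_fderiv_comp hφ hh v
  have e4 := fderiv_comp p (hφ.differentiableAt (by norm_num)) (hh.differentiableAt (by norm_num))
  have e5 : (fun q => φ (h q)) = φ ∘ h := rfl
  rw [covHess, covHess, e5, e3, e4, e2, e1, ContinuousLinearMap.comp_apply, e1]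
  ring

theorem contDiff_height {n : WithTop ℕ∞} : ContDiff ℝ n (fun p : E2Tilde => p 2) :=
  (EuclideanSpace.proj (𝕜 := ℝ) (2 : Fin 3) : E2Tilde →L[ℝ] ℝ).contDiff

theorem fderiv_height (p v : E2Tilde) : fderiv ℝ (fun p : E2Tilde => p 2) p v = v 2 :=
  congrArg (fun L => L v)
    (EuclideanSpace.proj (𝕜 := ℝ) (2 : Fin 3) : E2Tilde →L[ℝ] ℝ).hasFDerivAt.fderiv

theorem covHess_height (p v : E2Tilde) :
    covHess l₁ l₂ (fun p : E2Tilde => p 2) p v =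
      l₁ * l₂ * (l₁ ^ 2 - l₂ ^ 2) * (coframe l₁ l₂ p v 0 * coframe l₁ l₂ p v 1) := by
  have h : fderiv ℝ (fderiv ℝ (fun p : E2Tilde => p 2)) p v v = 0 := by
    refine fderiv_fderiv_eq_of_hasDerivAt (g' := fun _ => v 2) contDiff_height.contDiffAt
      (Eventually.of_forall fun τ => ?_) (hasDerivAt_const _ _)
    simpa using ((hasDerivAt_id τ).mul_const (v 2)).const_add (p 2)
  rw [covHess, h, fderiv_height]
  simp [christoffelVec, ofFrame]
  ring

end HessianCalculus

section EllipticRadius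

/-- The first of two functions whose restrictions to each plane `{x₃ = z}` are orthonormal affine
coordinates vanishing at `c`. -/
noncomputable def ellU (l₁ : ℝ) (c : Plane2) (p : E2Tilde) : ℝ :=
  l₁ * (Real.cos (p 2) * (p 0 - c 0) + Real.sin (p 2) * (p 1 - c 1))

/-- The second of two functions whose restrictions to each plane `{x₃ = z}` are orthonormal affine
coordinates vanishing at `c`. -/
noncomputable def ellV (l₂ : ℝ) (c : Plane2) (p : E2Tilde) : ℝ :=
  l₂ * (-Real.sin (p 2) * (p 0 - c 0) + Real.cos (p 2) * (p 1 - c 1))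

/-- The square of the distance, within the plane `{x₃ = z}` through `p`, from `p` to the vertical
line over `c`. -/
noncomputable def ellSq (l₁ l₂ : ℝ) (c : Plane2) (p : E2Tilde) : ℝ :=
  ellU l₁ c p ^ 2 + ellV l₂ c p ^ 2

theorem contDiff_ellSq (c : Plane2) {n : WithTop ℕ∞} : ContDiff ℝ n (ellSq l₁ l₂ c) := by
  have h : ∀ i : Fin 3, ContDiff ℝ n (fun p : E2Tilde => p i) := fun i =>
    (EuclideanSpace.proj (𝕜 := ℝ) i : E2Tilde →L[ℝ] ℝ).contDiff
  have h0 := h 0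
  have h1 := h 1
  have h2 := h 2
  have hc := Real.contDiff_cos.comp h2
  have hs := Real.contDiff_sin.comp h2
  exact (((contDiff_const.mul ((hc.mul (h0.sub contDiff_const)).add
    (hs.mul (h1.sub contDiff_const)))).pow 2).add
    ((contDiff_const.mul ((hs.neg.mul (h0.sub contDiff_const)).add
      (hc.mul (h1.sub contDiff_const)))).pow 2))

theorem hasDerivAt_ellU (h₁ : l₁ ≠ 0) (h₂ : l₂ ≠ 0) (c : Plane2) (p v : E2Tilde) (τ : ℝ) :
    HasDerivAt (fun τ : ℝ => ellU l₁ c (p + τ • v))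
      (coframe l₁ l₂ (p + τ • v) v 0
        + l₁ ^ 2 * ellV l₂ c (p + τ • v) * coframe l₁ l₂ (p + τ • v) v 2) τ := by
  have hl : ∀ i : Fin 3, HasDerivAt (fun τ : ℝ => (p + τ • v) i) (v i) τ := fun i => by
    simpa using ((hasDerivAt_id τ).mul_const (v i)).const_add (p i)
  have := ((((hl 2).cos.mul ((hl 0).sub_const (c 0))).add
    ((hl 2).sin.mul ((hl 1).sub_const (c 1)))).const_mul l₁)
  refine this.congr_deriv ?_
  simp [coframe, ellV]
  field_simp
  ring

theorem hasDerivAt_ellV (h₁ : l₁ ≠ 0) (h₂ : l₂ ≠ 0) (c : Plane2) (p v : E2Tilde) (τ : ℝ) :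
    HasDerivAt (fun τ : ℝ => ellV l₂ c (p + τ • v))
      (coframe l₁ l₂ (p + τ • v) v 1
        - l₂ ^ 2 * ellU l₁ c (p + τ • v) * coframe l₁ l₂ (p + τ • v) v 2) τ := by
  have hl : ∀ i : Fin 3, HasDerivAt (fun τ : ℝ => (p + τ • v) i) (v i) τ := fun i => by
    simpa using ((hasDerivAt_id τ).mul_const (v i)).const_add (p i)
  have := ((((hl 2).sin.neg.mul ((hl 0).sub_const (c 0))).add
    ((hl 2).cos.mul ((hl 1).sub_const (c 1)))).const_mul l₂)
  refine this.congr_deriv ?_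
  simp [coframe, ellU]
  field_simp
  ring

theorem hasDerivAt_coframe_zero (h₁ : l₁ ≠ 0) (h₂ : l₂ ≠ 0) (p v : E2Tilde) (τ : ℝ) :
    HasDerivAt (fun τ : ℝ => coframe l₁ l₂ (p + τ • v) v 0)
      (l₁ ^ 2 * coframe l₁ l₂ (p + τ • v) v 1 * coframe l₁ l₂ (p + τ • v) v 2) τ := by
  have hl : HasDerivAt (fun τ : ℝ => (p + τ • v) 2) (v 2) τ := by
    simpa using ((hasDerivAt_id τ).mul_const (v 2)).const_add (p 2)
  have := ((hl.cos.mul_const (v 0)).add (hl.sin.mul_const (v 1))).const_mul l₁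
  refine this.congr_deriv ?_
  simp [coframe]
  field_simp

theorem hasDerivAt_coframe_one (h₁ : l₁ ≠ 0) (h₂ : l₂ ≠ 0) (p v : E2Tilde) (τ : ℝ) :
    HasDerivAt (fun τ : ℝ => coframe l₁ l₂ (p + τ • v) v 1)
      (-(l₂ ^ 2 * coframe l₁ l₂ (p + τ • v) v 0 * coframe l₁ l₂ (p + τ • v) v 2)) τ := by
  have hl : HasDerivAt (fun τ : ℝ => (p + τ • v) 2) (v 2) τ := by
    simpa using ((hasDerivAt_id τ).mul_const (v 2)).const_add (p 2)
  have := ((hl.sin.neg.mul_const (v 0)).add (hl.cos.mul_const (v 1))).const_mul l₂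
  refine this.congr_deriv ?_
  simp [coframe]
  field_simp
  ring

theorem hasDerivAt_ellSq (h₁ : l₁ ≠ 0) (h₂ : l₂ ≠ 0) (c : Plane2) (p v : E2Tilde) (τ : ℝ) :
    HasDerivAt (fun τ : ℝ => ellSq l₁ l₂ c (p + τ • v))
      (2 * (ellU l₁ c (p + τ • v) * coframe l₁ l₂ (p + τ • v) v 0
        + ellV l₂ c (p + τ • v) * coframe l₁ l₂ (p + τ • v) v 1
        + (l₁ ^ 2 - l₂ ^ 2) * (ellU l₁ c (p + τ • v) * ellV l₂ c (p + τ • v))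
          * coframe l₁ l₂ (p + τ • v) v 2)) τ := by
  refine (((hasDerivAt_ellU h₁ h₂ c p v τ).pow 2).add
    ((hasDerivAt_ellV h₁ h₂ c p v τ).pow 2)).congr_deriv ?_
  simp
  ring

theorem fderiv_ellSq (h₁ : l₁ ≠ 0) (h₂ : l₂ ≠ 0) (c : Plane2) (p v : E2Tilde) :
    fderiv ℝ (ellSq l₁ l₂ c) p v = 2 * (ellU l₁ c p * coframe l₁ l₂ p v 0
        + ellV l₂ c p * coframe l₁ l₂ p v 1
        + (l₁ ^ 2 - l₂ ^ 2) * (ellU l₁ c p * ellV l₂ c p) * coframe l₁ l₂ p v 2) := by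
  have h := hasDerivAt_ellSq h₁ h₂ c p v 0
  have h0 : HasFDerivAt (ellSq l₁ l₂ c) (fderiv ℝ (ellSq l₁ l₂ c) p) (p + (0 : ℝ) • v) := by
    rw [zero_smul, add_zero]
    exact ((contDiff_ellSq (n := 1) c).differentiable (by norm_num) p).hasFDerivAt
  have h' := h0.comp_hasDerivAt (0 : ℝ) (hasDerivAt_line p v 0)
  rw [zero_smul, add_zero] at h
  exact h'.unique h

theorem covHess_ellSq (h₁ : l₁ ≠ 0) (h₂ : l₂ ≠ 0) (c : Plane2) (p v : E2Tilde) :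
    covHess l₁ l₂ (ellSq l₁ l₂ c) p v =
      2 * (coframe l₁ l₂ p v 0 ^ 2 + coframe l₁ l₂ p v 1 ^ 2
        + (l₁ ^ 2 - l₂ ^ 2) * coframe l₁ l₂ p v 2
          * (ellV l₂ c p * coframe l₁ l₂ p v 0 + ellU l₁ c p * coframe l₁ l₂ p v 1)
        + (l₁ ^ 2 - l₂ ^ 2) * (l₁ ^ 2 * ellV l₂ c p ^ 2 - l₂ ^ 2 * ellU l₁ c p ^ 2)
          * coframe l₁ l₂ p v 2 ^ 2
        + (l₁ ^ 2 - l₂ ^ 2) ^ 2 * (ellU l₁ c p * ellV l₂ c p)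
          * (coframe l₁ l₂ p v 0 * coframe l₁ l₂ p v 1)) := by
  have hω : HasDerivAt (fun τ : ℝ => coframe l₁ l₂ (p + τ • v) v 2) 0 0 := by
    simp only [coframe, Matrix.cons_val]
    exact hasDerivAt_const _ _
  have hU := hasDerivAt_ellU h₁ h₂ c p v 0
  have hV := hasDerivAt_ellV h₁ h₂ c p v 0
  have h2 := (((hU.mul (hasDerivAt_coframe_zero h₁ h₂ p v 0)).add
    (hV.mul (hasDerivAt_coframe_one h₁ h₂ p v 0))).add
      (((hU.mul hV).const_mul (l₁ ^ 2 - l₂ ^ 2)).mul hω)).const_mul 2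
  rw [covHess, fderiv_fderiv_eq_of_hasDerivAt (contDiff_ellSq c).contDiffAt
    (Eventually.of_forall (hasDerivAt_ellSq h₁ h₂ c p v)) h2, fderiv_ellSq h₁ h₂,
    christoffelVec, coframe_ofFrame h₁ h₂]
  simp
  ring

end EllipticRadius

end E2Tilde

/-! ### The barrier -/

namespace E2Tilde

variable {l₁ l₂ : ℝ}

/-- The rate `K` in the function `-exp (-K z)` of the height `z`. The height itself is not
superharmonic on minimal surfaces, since the trace of its Hessian on a plane with unit normal `n` is
`-l₁ l₂ (l₁² - l₂²) n₀ n₁`; with this `K`, the concavity of the exponential compensates for it. -/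
noncomputable def barrierRate (l₁ l₂ : ℝ) : ℝ := (l₁ ^ 2 - l₂ ^ 2 + 1) / (l₁ * l₂)

/-- The barrier. Where `ℓ + log (ellSq l₁ l₂ c)` is at least `1`, its Hessian has negative trace on
every plane, if `t` is small compared with the exponential. The sign `ς = ±1` says on which side of
the plane the surface lies. -/
noncomputable def barrier (l₁ l₂ ς t ℓ : ℝ) (c : Plane2) (p : E2Tilde) : ℝ :=
  -Real.exp (-(barrierRate l₁ l₂ * ς * p 2)) + t * Real.log (ℓ + Real.log (ellSq l₁ l₂ c p))

/-- A constant bounding the terms in the Hessian of the logarithmic part of the barrier which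
vanish on horizontal planes. -/
noncomputable def barrierConst (l₁ l₂ ℓ : ℝ) : ℝ :=
  13 * (l₁ ^ 2 - l₂ ^ 2) ^ 2 + 8 * Real.exp (ℓ - 1) + 2 * (l₁ ^ 2 - l₂ ^ 2) * l₁ ^ 2 + 1

theorem barrierConst_pos (h₂ : 0 < l₂) (hl : l₂ ≤ l₁) (ℓ : ℝ) : 0 < barrierConst l₁ l₂ ℓ := by
  have hD : 0 ≤ l₁ ^ 2 - l₂ ^ 2 := by nlinarith
  unfold barrierConst
  positivity

theorem contDiffAt_loglog {ℓ s : ℝ} (hs : 0 < s) (hL : 0 < ℓ + Real.log s) :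
    ContDiffAt ℝ 2 (fun s => Real.log (ℓ + Real.log s)) s :=
  (contDiffAt_const.add (Real.contDiffAt_log.2 hs.ne')).log hL.ne'

theorem covHess_loglog {t ℓ : ℝ} {c : Plane2} {p : E2Tilde}
    (hs : 0 < ellSq l₁ l₂ c p) (hL : 0 < ℓ + Real.log (ellSq l₁ l₂ c p)) (v : E2Tilde) :
    covHess l₁ l₂ (fun q => t * Real.log (ℓ + Real.log (ellSq l₁ l₂ c q))) p v =
      -t * ((ℓ + Real.log (ellSq l₁ l₂ c p))⁻¹ + ((ℓ + Real.log (ellSq l₁ l₂ c p))⁻¹) ^ 2)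
          / ellSq l₁ l₂ c p ^ 2 * fderiv ℝ (ellSq l₁ l₂ c) p v ^ 2
        + t * ((ℓ + Real.log (ellSq l₁ l₂ c p))⁻¹ / ellSq l₁ l₂ c p)
          * covHess l₁ l₂ (ellSq l₁ l₂ c) p v := by
  have hd : ∀ s : ℝ, 0 < s → HasDerivAt (fun s => ℓ + Real.log s) s⁻¹ s := fun s hs =>
    (Real.hasDerivAt_log hs.ne').const_add ℓ
  have hev : ∀ᶠ s in 𝓝 (ellSq l₁ l₂ c p), 0 < s ∧ 0 < ℓ + Real.log s :=
    (lt_mem_nhds hs).and ((hd _ hs).continuousAt.eventually (lt_mem_nhds hL))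
  refine covHess_comp (φ := fun s => t * Real.log (ℓ + Real.log s))
    (φ' := fun s => t * ((ℓ + Real.log s)⁻¹ / s)) (contDiff_ellSq c).contDiffAt
    (contDiffAt_const.mul (contDiffAt_loglog hs hL)) ?_ ?_ v
  · filter_upwards [hev] with s hs'
    refine (((hd s hs'.1).log hs'.2.ne').const_mul t).congr_deriv ?_
    rw [inv_eq_one_div, inv_eq_one_div]
    field_simp
  · refine ((((hd _ hs).inv hL.ne').div (hasDerivAt_id _) hs.ne').const_mul t).congr_deriv ?_
    simp only [id, Pi.inv_apply]
    field_simp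
    ring

theorem covHess_exp_height {k : ℝ} (p v : E2Tilde) :
    covHess l₁ l₂ (fun q : E2Tilde => -Real.exp (-(k * q 2))) p v =
      -(k ^ 2 * Real.exp (-(k * p 2))) * v 2 ^ 2 + k * Real.exp (-(k * p 2)) *
        (l₁ * l₂ * (l₁ ^ 2 - l₂ ^ 2) * (coframe l₁ l₂ p v 0 * coframe l₁ l₂ p v 1)) := by
  have hd : ∀ z : ℝ, HasDerivAt (fun z => Real.exp (-(k * z))) (-(k * Real.exp (-(k * z)))) z :=
    fun z => by
      refine (((hasDerivAt_id z).const_mul k).neg.exp).congr_deriv ?_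
      simp; ring
  have := covHess_comp (l₁ := l₁) (l₂ := l₂) (p := p) (φ := fun z => -Real.exp (-(k * z)))
    (φ' := fun z => k * Real.exp (-(k * z))) (φ'' := -(k ^ 2 * Real.exp (-(k * p 2))))
    contDiff_height.contDiffAt
    ((contDiff_const.mul contDiff_id).neg.exp.neg.contDiffAt)
    (Eventually.of_forall fun z => (hd z).neg.congr_deriv (by ring))
    (((hd (p 2)).const_mul k).congr_deriv (by ring)) v
  rw [this, fderiv_height, covHess_height]

theorem contDiffAt_barrier {ς t ℓ : ℝ} {c : Plane2} {p : E2Tilde}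
    (hs : 0 < ellSq l₁ l₂ c p) (hL : 0 < ℓ + Real.log (ellSq l₁ l₂ c p)) :
    ContDiffAt ℝ 2 (barrier l₁ l₂ ς t ℓ c) p :=
  ((contDiff_const.mul contDiff_height).neg.exp.neg.contDiffAt).add
    (contDiffAt_const.mul ((contDiffAt_loglog hs hL).comp p (contDiff_ellSq c).contDiffAt))

set_option maxHeartbeats 600000 in
/-- The trace over a plane with unit normal `(n₀, n₁, n₂)` of the Hessian of the double logarithm of
`s = U² + V²`, where `r` is the inverse of `ℓ + log s`. Horizontally it is `-4 r² / s`; the terms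
linear in `(n₀, n₁)` are of order `r / √s`, so Young's inequality absorbs them. -/
theorem loglog_trace_le {D E A U V r B n₀ n₁ n₂ : ℝ} (hD : 0 ≤ D) (hE : 0 ≤ E) (hEA : E ≤ A)
    (hs : 0 < U ^ 2 + V ^ 2) (hr : 0 < r) (hr1 : r ≤ 1) (hB : r / (U ^ 2 + V ^ 2) ≤ B)
    (hn : n₀ ^ 2 + n₁ ^ 2 + n₂ ^ 2 = 1) :
    -(r + r ^ 2) / (U ^ 2 + V ^ 2) ^ 2 *
        (4 * ((U ^ 2 + V ^ 2) + D ^ 2 * (U * V) ^ 2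
          - (U * n₀ + V * n₁ + D * (U * V) * n₂) ^ 2))
      + r / (U ^ 2 + V ^ 2) * (2 * (2 + D * (A * V ^ 2 - E * U ^ 2) - n₀ ^ 2 - n₁ ^ 2
          - D * n₂ * (V * n₀ + U * n₁) - D * (A * V ^ 2 - E * U ^ 2) * n₂ ^ 2
          - D ^ 2 * (U * V) * (n₀ * n₁)))
      ≤ -2 * r ^ 2 / (U ^ 2 + V ^ 2)
        + (13 * D ^ 2 + 8 * B + 2 * D * A) * (n₀ ^ 2 + n₁ ^ 2) := by
  obtain ⟨σ, hσ, hσs⟩ : ∃ σ, 0 < σ ∧ σ ^ 2 = U ^ 2 + V ^ 2 :=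
    ⟨√(U ^ 2 + V ^ 2), Real.sqrt_pos.2 hs, Real.sq_sqrt hs.le⟩
  obtain ⟨h, hh, hhs⟩ : ∃ h, 0 ≤ h ∧ h ^ 2 = n₀ ^ 2 + n₁ ^ 2 :=
    ⟨√(n₀ ^ 2 + n₁ ^ 2), Real.sqrt_nonneg _, Real.sq_sqrt (by positivity)⟩
  have hA : 0 ≤ A := hE.trans hEA
  have hn₂ : |n₂| ≤ 1 := abs_le_one_iff_mul_self_le_one.2 (by nlinarith)
  -- Cauchy–Schwarz bounds
  have hb : |U * n₀ + V * n₁| ≤ σ * h := abs_le_of_sq_le_sq (by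
    rw [mul_pow, hσs, hhs]; nlinarith [sq_nonneg (U * n₁ - V * n₀)]) (by positivity)
  have hc : |V * n₀ + U * n₁| ≤ σ * h := abs_le_of_sq_le_sq (by
    rw [mul_pow, hσs, hhs]; nlinarith [sq_nonneg (U * n₀ - V * n₁)]) (by positivity)
  have hUV : |U * V| ≤ σ ^ 2 / 2 := by
    rw [hσs, abs_le]; constructor <;> nlinarith [sq_nonneg (U - V), sq_nonneg (U + V)]
  have hnn : |n₀ * n₁| ≤ h ^ 2 / 2 := by
    rw [hhs, abs_le]; constructor <;> nlinarith [sq_nonneg (n₀ - n₁), sq_nonneg (n₀ + n₁)]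
  have hW : A * V ^ 2 - E * U ^ 2 ≤ A * σ ^ 2 := by
    rw [hσs]; nlinarith [sq_nonneg U, mul_nonneg hE (sq_nonneg U), mul_nonneg hA (sq_nonneg U)]
  set b := U * n₀ + V * n₁ with hbdef
  set m := V * n₀ + U * n₁ with hmdef
  set w := U * V with hwdef
  set W := A * V ^ 2 - E * U ^ 2 with hWdef
  clear_value b m w W
  have hn2 : n₂ ^ 2 = 1 - h ^ 2 := by rw [hhs]; linarith
  have e1 : |b * w * n₂| ≤ σ * h * (σ ^ 2 / 2) := by
    rw [abs_mul, abs_mul]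
    calc |b| * |w| * |n₂| ≤ (σ * h) * (σ ^ 2 / 2) * 1 := by gcongr
      _ = _ := mul_one _
  have e2 : |n₂ * m| ≤ σ * h := by
    rw [abs_mul]
    calc |n₂| * |m| ≤ 1 * (σ * h) := by gcongr
      _ = _ := one_mul _
  have e3 : |w * (n₀ * n₁)| ≤ σ ^ 2 / 2 * (h ^ 2 / 2) := by
    rw [abs_mul]; gcongr
  have e4 : b ^ 2 ≤ σ ^ 2 * h ^ 2 := by rw [← mul_pow, ← sq_abs b]; gcongr
  -- the second order part, up to its horizontal value
  have q1 : -(D ^ 2 * w ^ 2 * h ^ 2 - b ^ 2 - 2 * D * (b * w * n₂)) ≤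
      σ ^ 2 * h ^ 2 + D * (σ ^ 3 * h) := by
    have := mul_le_mul_of_nonneg_left (abs_le.1 e1).2 hD
    have h0 : 0 ≤ D ^ 2 * w ^ 2 * h ^ 2 := by positivity
    linarith
  have q2 : W * h ^ 2 * D - h ^ 2 - D * (n₂ * m) - D ^ 2 * (w * (n₀ * n₁)) ≤
      D * A * σ ^ 2 * h ^ 2 + D * (σ * h) + D ^ 2 * (σ ^ 2 / 2 * (h ^ 2 / 2)) := by
    have i1 := mul_le_mul_of_nonneg_left (abs_le.1 e2).1 hD
    have i2 := mul_le_mul_of_nonneg_left (abs_le.1 e3).1 (sq_nonneg D)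
    have i3 : W * h ^ 2 * D ≤ A * σ ^ 2 * h ^ 2 * D := by gcongr
    linarith [sq_nonneg h]
  rw [← hσs, ← hhs]
  rw [← hσs] at hB
  have hrr : 4 * (r + r ^ 2) / σ ^ 2 *
      (-(D ^ 2 * w ^ 2 * h ^ 2 - b ^ 2 - 2 * D * (b * w * n₂))) ≤
      8 * r / σ ^ 2 * (σ ^ 2 * h ^ 2 + D * (σ ^ 3 * h)) := by
    have h0 : 0 ≤ σ ^ 2 * h ^ 2 + D * (σ ^ 3 * h) := by positivity
    calc _ ≤ 4 * (r + r ^ 2) / σ ^ 2 * (σ ^ 2 * h ^ 2 + D * (σ ^ 3 * h)) := by gcongr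
      _ ≤ _ := by
        have h3 : 4 * (r + r ^ 2) ≤ 8 * r := by nlinarith
        exact mul_le_mul_of_nonneg_right (div_le_div_of_nonneg_right h3 (by positivity)) h0
  have young : 10 * D * (r * σ * h) ≤ 2 * r ^ 2 + 25 / 2 * (D ^ 2 * σ ^ 2 * h ^ 2) := by
    linarith [sq_nonneg (2 * r - 5 * D * σ * h)]
  have expand : σ ^ 2 * (-(r + r ^ 2) / (σ ^ 2) ^ 2 * (4 * (σ ^ 2 + D ^ 2 * w ^ 2
          - (b + D * w * n₂) ^ 2))
      + r / σ ^ 2 * (2 * (2 + D * W - n₀ ^ 2 - n₁ ^ 2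
          - D * n₂ * m - D * W * n₂ ^ 2 - D ^ 2 * w * (n₀ * n₁)))) =
      -4 * r ^ 2 + 4 * (r + r ^ 2) / σ ^ 2 *
        (-(D ^ 2 * w ^ 2 * h ^ 2 - b ^ 2 - 2 * D * (b * w * n₂)))
      + 2 * r * (W * h ^ 2 * D - h ^ 2 - D * (n₂ * m) - D ^ 2 * (w * (n₀ * n₁))) := by
    have : n₀ ^ 2 = h ^ 2 - n₁ ^ 2 := by rw [hhs]; ring
    field_simp
    rw [this, show (b + D * w * n₂) ^ 2 = b ^ 2 + 2 * D * (b * w * n₂) + D ^ 2 * w ^ 2 * n₂ ^ 2 by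
      ring, hn2]
    ring
  have hrσ : 8 * r / σ ^ 2 * (σ ^ 2 * h ^ 2 + D * (σ ^ 3 * h)) =
      8 * (r * h ^ 2) + 8 * D * (r * σ * h) := by
    field_simp
  refine le_of_mul_le_mul_left ?_ (by positivity : 0 < σ ^ 2)
  rw [expand]
  have final : σ ^ 2 * (-2 * r ^ 2 / σ ^ 2 + (13 * D ^ 2 + 8 * B + 2 * D * A) * h ^ 2) =
      -2 * r ^ 2 + σ ^ 2 * (13 * D ^ 2 + 8 * B + 2 * D * A) * h ^ 2 := by
    field_simp
  rw [final]
  have hB' : r * h ^ 2 ≤ σ ^ 2 * B * h ^ 2 := by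
    have := (div_le_iff₀ (by positivity : 0 < σ ^ 2)).1 hB
    calc r * h ^ 2 ≤ B * σ ^ 2 * h ^ 2 := by gcongr
      _ = _ := by ring
  have f1 : r * (D * A * σ ^ 2 * h ^ 2) ≤ 1 * (D * A * σ ^ 2 * h ^ 2) := by gcongr
  have f2 : r * (D ^ 2 * (σ ^ 2 / 2 * (h ^ 2 / 2))) ≤ 1 * (D ^ 2 * (σ ^ 2 / 2 * (h ^ 2 / 2))) := by
    gcongr
  have f3 := mul_le_mul_of_nonneg_left q2 hr.le
  linarith

/-- The trace of the Hessian of the height part of the barrier is at most a negative multiple of the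
squared sine of the angle between the plane and the horizontal. -/
theorem height_trace_le {D κ K P ς n₀ n₁ n₂ : ℝ} (hD : 0 ≤ D) (hK : K * κ = D + 1)
    (hP : 0 < P) (hς : ς = 1 ∨ ς = -1) (hn : n₀ ^ 2 + n₁ ^ 2 + n₂ ^ 2 = 1) :
    -((K * ς) ^ 2 * P) * (κ ^ 2 * (1 - n₂ ^ 2)) + K * ς * P * (κ * D * (-(n₀ * n₁)))
      ≤ -(P / 2) * (n₀ ^ 2 + n₁ ^ 2) := by
  have h2 : 1 - n₂ ^ 2 = n₀ ^ 2 + n₁ ^ 2 := by linarith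
  have key : D * (D + 1) * (-(ς * (n₀ * n₁))) ≤ D * (D + 1) * ((n₀ ^ 2 + n₁ ^ 2) / 2) := by
    refine mul_le_mul_of_nonneg_left ?_ (by positivity)
    rcases hς with rfl | rfl <;> nlinarith [sq_nonneg (n₀ - n₁), sq_nonneg (n₀ + n₁)]
  have hς2 : ς ^ 2 = 1 := by rcases hς with rfl | rfl <;> norm_num
  have e : -((K * ς) ^ 2 * P) * (κ ^ 2 * (1 - n₂ ^ 2)) + K * ς * P * (κ * D * (-(n₀ * n₁))) =
      P * (-((K * κ) ^ 2 * ς ^ 2) * (n₀ ^ 2 + n₁ ^ 2) + D * (K * κ) * (-(ς * (n₀ * n₁)))) := by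
    rw [h2]; ring
  rw [e, hK, hς2]
  have : -((D + 1) ^ 2 * 1) * (n₀ ^ 2 + n₁ ^ 2) + D * (D + 1) * (-(ς * (n₀ * n₁))) ≤
      -(1 / 2) * (n₀ ^ 2 + n₁ ^ 2) := by
    have h0 : 0 ≤ D * (n₀ ^ 2 + n₁ ^ 2) := by positivity
    have h1 : 0 ≤ D ^ 2 * (n₀ ^ 2 + n₁ ^ 2) := by positivity
    nlinarith [sq_nonneg n₀, sq_nonneg n₁]
  nlinarith

/-- If `x`, `y` are orthogonal vectors of `ℝ³` of squared length `k`, then the sum of their tensor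
squares is `k (1 - n ⊗ n)`, with `n` the unit vector in the direction of their cross product. -/
theorem exists_unit_normal_of_orthogonal {x y : Fin 3 → ℝ} {k : ℝ} (hk : 0 < k)
    (hx : x 0 * x 0 + x 1 * x 1 + x 2 * x 2 = k) (hy : y 0 * y 0 + y 1 * y 1 + y 2 * y 2 = k)
    (hxy : x 0 * y 0 + x 1 * y 1 + x 2 * y 2 = 0) :
    ∃ n : Fin 3 → ℝ, n 0 ^ 2 + n 1 ^ 2 + n 2 ^ 2 = 1 ∧
      (∀ i, x i ^ 2 + y i ^ 2 = k * (1 - n i ^ 2)) ∧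
      ∀ i j, i ≠ j → x i * x j + y i * y j = k * (-(n i * n j)) := by
  have hk' := hk.ne'
  refine ⟨![(x 1 * y 2 - x 2 * y 1) / k, (x 2 * y 0 - x 0 * y 2) / k,
    (x 0 * y 1 - x 1 * y 0) / k], ?_, fun i => ?_, fun i j hij => ?_⟩
  · simp only [Matrix.cons_val, div_pow, ← add_div]
    rw [div_eq_one_iff_eq (by positivity)]
    linear_combination (y 0 * y 0 + y 1 * y 1 + y 2 * y 2) * hx + k * hy
      - (x 0 * y 0 + x 1 * y 1 + x 2 * y 2) * hxy
  · have aux : ∀ a z : ℝ, k * a = k ^ 2 - z ^ 2 → a = k * (1 - (z / k) ^ 2) := fun a z h => by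
      field_simp; linarith
    fin_cases i <;> refine aux _ _ ?_ <;> simp
    · linear_combination (-x 0 ^ 2 + k) * hy + (-y 0 ^ 2 + y 0 * y 0 + y 1 * y 1 + y 2 * y 2) * hx
        + (2 * (x 0 * y 0) - (x 0 * y 0 + x 1 * y 1 + x 2 * y 2)) * hxy
    · linear_combination (-x 1 ^ 2 + k) * hy + (-y 1 ^ 2 + y 0 * y 0 + y 1 * y 1 + y 2 * y 2) * hx
        + (2 * (x 1 * y 1) - (x 0 * y 0 + x 1 * y 1 + x 2 * y 2)) * hxy
    · linear_combination (-x 2 ^ 2 + k) * hy + (-y 2 ^ 2 + y 0 * y 0 + y 1 * y 1 + y 2 * y 2) * hx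
        + (2 * (x 2 * y 2) - (x 0 * y 0 + x 1 * y 1 + x 2 * y 2)) * hxy
  · have aux : ∀ a z z' : ℝ, k * a = -(z * z') → a = k * (-(z / k * (z' / k))) :=
      fun a z z' h => by field_simp; linarith
    fin_cases i <;> fin_cases j <;> first | exact absurd rfl hij | skip
    all_goals
      refine aux _ _ _ ?_
      simp
    · linear_combination (-(x 0 * x 1)) * hy - y 0 * y 1 * hx + (x 0 * y 1 + x 1 * y 0) * hxy
    · linear_combination (-(x 0 * x 2)) * hy - y 0 * y 2 * hx + (x 0 * y 2 + x 2 * y 0) * hxy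
    · linear_combination (-(x 1 * x 0)) * hy - y 1 * y 0 * hx + (x 1 * y 0 + x 0 * y 1) * hxy
    · linear_combination (-(x 1 * x 2)) * hy - y 1 * y 2 * hx + (x 1 * y 2 + x 2 * y 1) * hxy
    · linear_combination (-(x 2 * x 0)) * hy - y 2 * y 0 * hx + (x 2 * y 0 + x 0 * y 2) * hxy
    · linear_combination (-(x 2 * x 1)) * hy - y 2 * y 1 * hx + (x 2 * y 1 + x 1 * y 2) * hxy

/-- On every plane of tangent vectors, given by an orthogonal basis of two vectors of the same
length, the trace of the Hessian of the barrier is negative. -/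
theorem covHess_barrier_add_neg (h₂ : 0 < l₂) (hl : l₂ ≤ l₁) {ς t ℓ : ℝ} {c : Plane2} {p : E2Tilde}
    (hς : ς = 1 ∨ ς = -1) (ht : 0 < t)
    (hs : 0 < ellSq l₁ l₂ c p) (hL : 1 ≤ ℓ + Real.log (ellSq l₁ l₂ c p))
    (htP : 2 * t * barrierConst l₁ l₂ ℓ ≤ Real.exp (-(barrierRate l₁ l₂ * ς * p 2)))
    {X Y : E2Tilde} (hX : 0 < metric l₁ l₂ p X X) (hY : metric l₁ l₂ p Y Y = metric l₁ l₂ p X X)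
    (hXY : metric l₁ l₂ p X Y = 0) :
    covHess l₁ l₂ (barrier l₁ l₂ ς t ℓ c) p X + covHess l₁ l₂ (barrier l₁ l₂ ς t ℓ c) p Y < 0 := by
  have h₁ : 0 < l₁ := h₂.trans_le hl
  have hD : 0 ≤ l₁ ^ 2 - l₂ ^ 2 := by nlinarith
  have hL0 : 0 < ℓ + Real.log (ellSq l₁ l₂ c p) := by linarith
  have hadd := covHess_add (l₁ := l₁) (l₂ := l₂)
    (G := fun q : E2Tilde => -Real.exp (-(barrierRate l₁ l₂ * ς * q 2)))
    (H := fun q => t * Real.log (ℓ + Real.log (ellSq l₁ l₂ c q))) (p := p)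
    ((contDiff_const.mul contDiff_height).neg.exp.neg.contDiffAt)
    (contDiffAt_const.mul ((contDiffAt_loglog hs hL0).comp p (contDiff_ellSq c).contDiffAt))
  have hbar : barrier l₁ l₂ ς t ℓ c = fun q => -Real.exp (-(barrierRate l₁ l₂ * ς * q 2))
      + t * Real.log (ℓ + Real.log (ellSq l₁ l₂ c q)) := rfl
  have hv2 : ∀ v : E2Tilde, v 2 = l₁ * l₂ * coframe l₁ l₂ p v 2 := by
    intro v; simp [coframe]; field_simp
  rw [hbar, hadd, hadd, covHess_exp_height, covHess_exp_height, covHess_loglog hs hL0,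
    covHess_loglog hs hL0, covHess_ellSq h₁.ne' h₂.ne', covHess_ellSq h₁.ne' h₂.ne',
    fderiv_ellSq h₁.ne' h₂.ne', fderiv_ellSq h₁.ne' h₂.ne', hv2 X, hv2 Y]
  rw [metric_eq_coframe] at hY hXY
  obtain ⟨k, hk⟩ : ∃ k, metric l₁ l₂ p X X = k := ⟨_, rfl⟩
  rw [hk] at hX hY
  rw [metric_eq_coframe] at hk
  obtain ⟨n, hn, hd, ho⟩ := exists_unit_normal_of_orthogonal hX hk hY hXY
  have d0 := hd 0
  have d1 := hd 1
  have d2 := hd 2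
  have o01 := ho 0 1 (by decide)
  have o02 := ho 0 2 (by decide)
  have o12 := ho 1 2 (by decide)
  generalize coframe l₁ l₂ p X = x at *
  generalize coframe l₁ l₂ p Y = y at *
  generalize hP : Real.exp (-(barrierRate l₁ l₂ * ς * p 2)) = P at *
  have hPpos : 0 < P := hP ▸ Real.exp_pos _
  have hr : 0 < (ℓ + Real.log (ellSq l₁ l₂ c p))⁻¹ := inv_pos.2 hL0
  have hr1 : (ℓ + Real.log (ellSq l₁ l₂ c p))⁻¹ ≤ 1 := inv_le_one_of_one_le₀ hL
  have hrB : (ℓ + Real.log (ellSq l₁ l₂ c p))⁻¹ / ellSq l₁ l₂ c p ≤ Real.exp (ℓ - 1) := by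
    have h3 : Real.exp (1 - ℓ) ≤ ellSq l₁ l₂ c p :=
      (Real.le_log_iff_exp_le hs).1 (by linarith)
    rw [div_le_iff₀ hs]
    calc _ ≤ 1 := hr1
      _ = Real.exp (ℓ - 1) * Real.exp (1 - ℓ) := by rw [← Real.exp_add]; simp
      _ ≤ _ := by gcongr
  generalize (ℓ + Real.log (ellSq l₁ l₂ c p))⁻¹ = r at *
  have hsq : ellSq l₁ l₂ c p = ellU l₁ c p ^ 2 + ellV l₂ c p ^ 2 := rfl
  rw [hsq] at hrB hs ⊢
  generalize ellU l₁ c p = U at *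
  generalize ellV l₂ c p = V at *
  have T := loglog_trace_le hD (sq_nonneg l₂) (by linarith : l₂ ^ 2 ≤ l₁ ^ 2) hs hr hr1 hrB hn
  have hK : barrierRate l₁ l₂ * (l₁ * l₂) = l₁ ^ 2 - l₂ ^ 2 + 1 := by
    unfold barrierRate; field_simp
  have Hh := height_trace_le hD hK hPpos hς hn
  have hbc : barrierConst l₁ l₂ ℓ = 13 * (l₁ ^ 2 - l₂ ^ 2) ^ 2 + 8 * Real.exp (ℓ - 1)
    + 2 * (l₁ ^ 2 - l₂ ^ 2) * l₁ ^ 2 + 1 := rfl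
  rw [hbc] at htP
  generalize barrierRate l₁ l₂ = K at *
  generalize Real.exp (ℓ - 1) = B at *
  obtain ⟨D, hDdef⟩ : ∃ D, l₁ ^ 2 - l₂ ^ 2 = D := ⟨_, rfl⟩
  rw [hDdef] at T Hh htP ⊢
  obtain ⟨S, hS⟩ : ∃ S, U ^ 2 + V ^ 2 = S := ⟨_, rfl⟩
  rw [hS] at hs
  have hrS : 0 < r ^ 2 / S := by positivity
  have inner := add_lt_add_of_le_of_lt Hh (mul_lt_mul_of_pos_left
    (lt_of_le_of_lt T (show _ < (13 * D ^ 2 + 8 * B + 2 * D * l₁ ^ 2) * (n 0 ^ 2 + n 1 ^ 2) by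
      rw [hS, mul_div_assoc]; linarith)) ht)
  have hneg : -(P / 2) * (n 0 ^ 2 + n 1 ^ 2)
      + t * ((13 * D ^ 2 + 8 * B + 2 * D * l₁ ^ 2) * (n 0 ^ 2 + n 1 ^ 2)) ≤ 0 := by
    have : 0 ≤ n 0 ^ 2 + n 1 ^ 2 := by positivity
    linarith [mul_nonneg ht.le this, mul_le_mul_of_nonneg_right htP this]
  have hfin := mul_neg_of_pos_of_neg hX (inner.trans_le hneg)
  refine lt_of_eq_of_lt ?_ hfin
  rw [hS]
  linear_combination
    (-((K * ς) ^ 2 * P) * (l₁ * l₂) ^ 2) * d2 + (K * ς * P * (l₁ * l₂ * D)) * o01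
    - t * (r + r ^ 2) / S ^ 2 * 4 * (U ^ 2 * d0 + V ^ 2 * d1 + D ^ 2 * (U * V) ^ 2 * d2
      + 2 * (U * V) * o01 + 2 * U * (D * (U * V)) * o02 + 2 * V * (D * (U * V)) * o12)
    + t * (r / S) * 2 * (d0 + d1 + D * V * o02 + D * U * o12
      + D * (l₁ ^ 2 * V ^ 2 - l₂ ^ 2 * U ^ 2) * d2 + D ^ 2 * (U * V) * o01)
    - (4 * k * t * (r + r ^ 2) / S ^ 2) * hS

end E2Tilde

/-! ### Minimal surfaces in charts -/

namespace E2Tilde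

variable {l₁ l₂ : ℝ}

/-- The projection `(x₁, x₂, x₃) ↦ (x₁, x₂)`. -/
noncomputable def horizProj : E2Tilde →L[ℝ] Plane2 :=
  (EuclideanSpace.equiv (Fin 2) ℝ).symm.toContinuousLinearMap.comp
    (ContinuousLinearMap.pi fun i : Fin 2 =>
      (EuclideanSpace.proj (𝕜 := ℝ) i.castSucc : E2Tilde →L[ℝ] ℝ))

@[simp] theorem horizProj_zero (p : E2Tilde) : horizProj p 0 = p 0 := rfl

@[simp] theorem horizProj_one (p : E2Tilde) : horizProj p 1 = p 1 := rfl

section Chart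

theorem isLocalMin_comp_chart_symm {M : Type*} [TopologicalSpace M]
    [ChartedSpace Plane2 M] {g : M → ℝ} {x : M} (h : IsLocalMin g x) :
    IsLocalMin (g ∘ (chartAt Plane2 x).symm) (chartAt Plane2 x x) := by
  have h1 := (chartAt Plane2 x).continuousAt_symm (mem_chart_target Plane2 x)
  have hx := (chartAt Plane2 x).left_inv (mem_chart_source Plane2 x)
  refine IsLocalMin.comp_continuous (b := chartAt Plane2 x x) ?_ h1
  rwa [hx]

variable {M : Type*} [TopologicalSpace M] [ChartedSpace Plane2 M] [IsManifold (𝓡 2) ∞ M]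
  {f : M → E2Tilde}

theorem IsSmoothImmersion.contDiffAt_chart (hf : IsSmoothImmersion f) (x : M) :
    ContDiffAt ℝ ∞ (f ∘ (chartAt Plane2 x).symm) (chartAt Plane2 x x) := by
  have h1 := contMDiffAt_symm_of_mem_maximalAtlas (I := 𝓡 2) (n := ∞)
    (IsManifold.chart_mem_maximalAtlas (I := 𝓡 2) (n := ∞) x) (mem_chart_target Plane2 x)
  exact contMDiffAt_iff_contDiffAt.1 (ContMDiffAt.comp _ hf.1.contMDiffAt h1)

theorem IsSmoothImmersion.injective_fderiv_chart (hf : IsSmoothImmersion f) (x : M) :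
    Function.Injective (fderiv ℝ (f ∘ (chartAt Plane2 x).symm) (chartAt Plane2 x x)) := by
  have hu := mem_chart_target Plane2 x
  have he := mdifferentiable_chart (I := 𝓡 2) x
  have h1 : MDifferentiableAt (𝓡 2) (𝓡 3) f ((chartAt Plane2 x).symm (chartAt Plane2 x x)) :=
    hf.1.mdifferentiableAt (by simp)
  have h2 := mfderiv_comp (chartAt Plane2 x x) h1 (he.symm.mdifferentiableAt hu)
  rw [← mfderiv_eq_fderiv]
  have h3 : Function.Injective (mfderiv (𝓡 2) (𝓡 3) (f ∘ (chartAt Plane2 x).symm)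
      (chartAt Plane2 x x)) := by
    rw [h2]
    exact (hf.2 _).comp (he.symm.mfderiv_injective hu)
  exact h3

/-- The maximum principle for the barrier on a minimal surface. -/
theorem IsProperMinimalImmersion.not_isLocalMin_barrier (hf : IsProperMinimalImmersion l₁ l₂ f)
    (h₂ : 0 < l₂) (hl : l₂ ≤ l₁) {ς t ℓ : ℝ} {c : Plane2} {x : M}
    (hς : ς = 1 ∨ ς = -1) (ht : 0 < t)
    (hs : 0 < ellSq l₁ l₂ c (f x)) (hL : 1 ≤ ℓ + Real.log (ellSq l₁ l₂ c (f x)))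
    (htP : 2 * t * barrierConst l₁ l₂ ℓ ≤ Real.exp (-(barrierRate l₁ l₂ * ς * f x 2))) :
    ¬ IsLocalMin (fun y => barrier l₁ l₂ ς t ℓ c (f y)) x := by
  intro hloc
  have hx := (chartAt Plane2 x).left_inv (mem_chart_source Plane2 x)
  have hp : (f ∘ (chartAt Plane2 x).symm) (chartAt Plane2 x x) = f x := by
    rw [Function.comp_apply, hx]
  obtain ⟨X, Y, hX, hY, hXY, hpos⟩ := exists_covHess_add_nonneg (h₂.trans_le hl) h₂
    ((hf.immersion.contDiffAt_chart x).of_le (by norm_cast))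
    (hf.immersion.injective_fderiv_chart x)
    (hf.minimal _ (IsManifold.chart_mem_maximalAtlas x) _ (mem_chart_target Plane2 x))
    (G := barrier l₁ l₂ ς t ℓ c)
    (by rw [hp]; exact contDiffAt_barrier hs (by linarith))
    (isLocalMin_comp_chart_symm hloc)
  rw [hp] at hX hY hXY hpos
  exact absurd hpos (not_le.2 (covHess_barrier_add_neg h₂ hl hς ht hs hL htP hX hY hXY))

/-- Where the height has a local extremum, the surface is locally a graph over the horizontal
plane. -/
theorem IsSmoothImmersion.exists_openPartialHomeomorph (hf : IsSmoothImmersion f) {ς : ℝ}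
    (hς : ς ≠ 0) {x : M} (hx : IsLocalMin (fun y => ς * f y 2) x) :
    ∃ φ : OpenPartialHomeomorph M Plane2, x ∈ φ.source ∧
      EqOn (fun y => horizProj (f y)) φ φ.source := by
  set e := chartAt Plane2 x with he
  set F := f ∘ e.symm with hF
  have hFd : HasStrictFDerivAt F (fderiv ℝ F (e x)) (e x) :=
    (hf.contDiffAt_chart x).hasStrictFDerivAt (by simp)
  have hinj := hf.injective_fderiv_chart x
  have hhor : ∀ v, fderiv ℝ F (e x) v 2 = 0 := by
    intro v
    have h1 := (isLocalMin_comp_chart_symm hx).fderiv_eq_zero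
    have h2 := ((EuclideanSpace.proj (𝕜 := ℝ) (2 : Fin 3) : E2Tilde →L[ℝ] ℝ).hasFDerivAt.comp
      (e x) hFd.hasFDerivAt).const_mul ς
    have h3 := congrArg (fun L => L v) (h2.fderiv.symm.trans h1)
    have h4 : ς * fderiv ℝ F (e x) v 2 = 0 := h3
    exact (mul_eq_zero.1 h4).resolve_left hς
  have hinj' : Function.Injective (horizProj.comp (fderiv ℝ F (e x))) := by
    intro v w hvw
    refine hinj ?_
    ext i
    fin_cases i
    · exact congrArg (fun q : Plane2 => q 0) hvw
    · exact congrArg (fun q : Plane2 => q 1) hvw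
    · exact (hhor v).trans (hhor w).symm
  set L : Plane2 ≃L[ℝ] Plane2 := (LinearEquiv.ofInjectiveEndo
    (horizProj.comp (fderiv ℝ F (e x))).toLinearMap hinj').toContinuousLinearEquiv with hL
  have hLe : (L : Plane2 →L[ℝ] Plane2) = horizProj.comp (fderiv ℝ F (e x)) := by
    ext v; rfl
  have hP : HasStrictFDerivAt (fun u => horizProj (F u)) (L : Plane2 →L[ℝ] Plane2) (e x) := by
    rw [hLe]
    exact horizProj.hasStrictFDerivAt.comp (e x) hFd
  refine ⟨e.trans (hP.toOpenPartialHomeomorph _), ?_, ?_⟩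
  · rw [OpenPartialHomeomorph.trans_source]
    exact ⟨mem_chart_source Plane2 x, hP.mem_toOpenPartialHomeomorph_source⟩
  · intro y hy
    rw [OpenPartialHomeomorph.trans_source] at hy
    simp only [OpenPartialHomeomorph.coe_trans, Function.comp_apply,
      HasStrictFDerivAt.toOpenPartialHomeomorph_coe, hF]
    rw [e.left_inv hy.1]

end Chart

end E2Tilde

/-! ### The global argument -/

namespace E2Tilde

variable {l₁ l₂ : ℝ}

theorem barrierRate_pos (h₂ : 0 < l₂) (hl : l₂ ≤ l₁) : 0 < barrierRate l₁ l₂ := by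
  have h₁ : 0 < l₁ := h₂.trans_le hl
  have hD : 0 ≤ l₁ ^ 2 - l₂ ^ 2 := by nlinarith
  unfold barrierRate
  positivity

theorem le_ellSq (h₂ : 0 < l₂) (hl : l₂ ≤ l₁) (c : Plane2) (p : E2Tilde) :
    l₂ ^ 2 * ((p 0 - c 0) ^ 2 + (p 1 - c 1) ^ 2) ≤ ellSq l₁ l₂ c p := by
  have h : l₂ ^ 2 ≤ l₁ ^ 2 := by gcongr
  have hsc := Real.sin_sq_add_cos_sq (p 2)
  have h2 := mul_le_mul_of_nonneg_right h
    (sq_nonneg (Real.cos (p 2) * (p 0 - c 0) + Real.sin (p 2) * (p 1 - c 1)))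
  have h3 : ellSq l₁ l₂ c p - l₂ ^ 2 * ((p 0 - c 0) ^ 2 + (p 1 - c 1) ^ 2) =
      (l₁ ^ 2 - l₂ ^ 2) *
        (Real.cos (p 2) * (p 0 - c 0) + Real.sin (p 2) * (p 1 - c 1)) ^ 2 := by
    simp only [ellSq, ellU, ellV]
    linear_combination (l₂ ^ 2 * ((p 0 - c 0) ^ 2 + (p 1 - c 1) ^ 2)) * hsc
  linarith

theorem ellSq_pos (h₂ : 0 < l₂) (hl : l₂ ≤ l₁) {c : Plane2} {p : E2Tilde} (h : horizProj p ≠ c) :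
    0 < ellSq l₁ l₂ c p := by
  refine lt_of_lt_of_le ?_ (le_ellSq h₂ hl c p)
  refine mul_pos (by positivity) ?_
  by_contra! hle
  have h0 : p 0 - c 0 = 0 := by nlinarith [sq_nonneg (p 0 - c 0), sq_nonneg (p 1 - c 1)]
  have h1 : p 1 - c 1 = 0 := by nlinarith [sq_nonneg (p 0 - c 0), sq_nonneg (p 1 - c 1)]
  apply h
  ext i
  fin_cases i
  · exact sub_eq_zero.1 h0
  · exact sub_eq_zero.1 h1

theorem ellSq_horizProj (p : E2Tilde) : ellSq l₁ l₂ (horizProj p) p = 0 := by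
  simp [ellSq, ellU, ellV]

theorem continuous_ellSq_horizProj {M : Type*} [TopologicalSpace M] {f : M → E2Tilde}
    (hf : Continuous f) :
    Continuous fun q : M × M => ellSq l₁ l₂ (horizProj (f q.1)) (f q.2) := by
  simp only [ellSq, ellU, ellV, horizProj_zero, horizProj_one]
  fun_prop

theorem isCompact_ellSq_le (h₂ : 0 < l₂) (hl : l₂ ≤ l₁) {ς : ℝ} (hς : ς = 1 ∨ ς = -1)
    (R b d : ℝ) :
    IsCompact {p : E2Tilde | ellSq l₁ l₂ 0 p ≤ R ∧ b ≤ ς * p 2 ∧ ς * p 2 ≤ d} := by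
  refine Metric.isCompact_of_isClosed_isBounded ?_ ?_
  · have h1 : Continuous (ellSq l₁ l₂ 0) := (contDiff_ellSq (n := 1) 0).continuous
    have h2 : Continuous fun p : E2Tilde => ς * p 2 := by fun_prop
    exact (isClosed_le h1 continuous_const).inter
      ((isClosed_le continuous_const h2).inter (isClosed_le h2 continuous_const))
  · refine (Metric.isBounded_iff_subset_closedBall 0).2
      ⟨√(R / l₂ ^ 2 + (b ^ 2 + d ^ 2)), fun p hp => ?_⟩
    rw [mem_closedBall_zero_iff, EuclideanSpace.norm_eq]
    refine Real.sqrt_le_sqrt ?_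
    simp only [Real.norm_eq_abs, sq_abs, Fin.sum_univ_three]
    have h1 := (le_ellSq h₂ hl 0 p).trans hp.1
    simp only [PiLp.zero_apply, sub_zero] at h1
    have h3 : p 0 ^ 2 + p 1 ^ 2 ≤ R / l₂ ^ 2 := by
      rw [le_div_iff₀ (by positivity)]; linarith
    have h4 : p 2 ^ 2 = (ς * p 2) ^ 2 := by rcases hς with rfl | rfl <;> ring
    have h5 : (ς * p 2) ^ 2 ≤ b ^ 2 + d ^ 2 := by
      rcases le_total 0 (ς * p 2) with h | h
      · nlinarith [hp.2.2, sq_nonneg b]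
      · nlinarith [hp.2.1, sq_nonneg d]
    linarith

theorem exists_pos_mul_le_mul_lt (A B : ℝ) {a e : ℝ} (ha : 0 < a) (he : 0 < e) :
    ∃ t : ℝ, 0 < t ∧ t * A ≤ a ∧ t * B < e := by
  have h1 : ∀ᶠ t : ℝ in 𝓝 0, t * A < a ∧ t * B < e := by
    refine Eventually.and ?_ ?_
    · exact (continuous_mul_const A).tendsto' 0 0 (by simp) |>.eventually (gt_mem_nhds ha)
    · exact (continuous_mul_const B).tendsto' 0 0 (by simp) |>.eventually (gt_mem_nhds he)
  obtain ⟨t, ht, h⟩ := ((h1.filter_mono nhdsWithin_le_nhds).and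
    (self_mem_nhdsWithin : Ioi (0 : ℝ) ∈ 𝓝[>] 0)).exists
  exact ⟨t, h, ht.1.le, ht.2⟩

variable {M : Type*} [TopologicalSpace M] [ChartedSpace Plane2 M] [IsManifold (𝓡 2) ∞ M]
  {f : M → E2Tilde}

/-- A properly immersed minimal surface on one side of a horizontal plane attains its extreme
height: otherwise its part close to the infimum of the height lies outside a vertical cylinder, and
there the barrier, which tends to infinity along that part, would have an interior minimum. -/
theorem IsProperMinimalImmersion.exists_forall_height_le [Nonempty M]
    (hf : IsProperMinimalImmersion l₁ l₂ f)
    (h₂ : 0 < l₂) (hl : l₂ ≤ l₁) {ς : ℝ} (hς : ς = 1 ∨ ς = -1) {a : ℝ}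
    (ha : ∀ x, a ≤ ς * f x 2) : ∃ x₀, ∀ x, ς * f x₀ 2 ≤ ς * f x 2 := by
  by_contra! hno
  have hfc : Continuous f := hf.proper.continuous
  have hZ : Continuous fun x => ς * f x 2 := by fun_prop
  have hσ : Continuous fun x => ellSq l₁ l₂ 0 (f x) :=
    (contDiff_ellSq (n := 1) 0).continuous.comp hfc
  have hK := barrierRate_pos h₂ hl
  have hC := barrierConst_pos h₂ hl 0
  set K := barrierRate l₁ l₂ with hKdef
  set C := barrierConst l₁ l₂ 0 with hCdef
  have hbdd : BddBelow (range fun x => ς * f x 2) := ⟨a, by rintro _ ⟨x, rfl⟩; exact ha x⟩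
  obtain ⟨b, hbdef⟩ : ∃ b, b = ⨅ x, ς * f x 2 := ⟨_, rfl⟩
  have hb : ∀ x, b ≤ ς * f x 2 := fun x => hbdef ▸ ciInf_le hbdd x
  have hb' : ∀ x, b < ς * f x 2 := fun x => by
    obtain ⟨y, hy⟩ := hno x
    exact (hb y).trans_lt hy
  have hcpt : ∀ R d : ℝ, IsCompact {x | ellSq l₁ l₂ 0 (f x) ≤ R ∧ ς * f x 2 ≤ d} := by
    intro R d
    refine (hf.proper.isCompact_preimage (isCompact_ellSq_le h₂ hl hς R b d)).of_isClosed_subset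
      ((isClosed_le hσ continuous_const).inter (isClosed_le hZ continuous_const)) ?_
    intro x hx
    exact ⟨hx.1, hb x, hx.2⟩
  obtain ⟨b', hbb', hb'le⟩ := (hcpt (Real.exp 1) (b + 1)).exists_forall_le' hZ.continuousOn
    (fun x _ => hb' x)
  obtain ⟨d, hbd, hdb', hd1⟩ : ∃ d, b < d ∧ d < b' ∧ d ≤ b + 1 :=
    ⟨min ((b + b') / 2) (b + 1), lt_min (by linarith) (by linarith),
      (min_le_left _ _).trans_lt (by linarith), min_le_right _ _⟩
  -- below height `d`, the surface is outside a cylinder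
  have hout : ∀ x, ς * f x 2 ≤ d → Real.exp 1 < ellSq l₁ l₂ 0 (f x) := by
    intro x hx
    by_contra! h
    exact absurd (hb'le x ⟨h, hx.trans hd1⟩) (not_le.2 (hx.trans_lt hdb'))
  obtain ⟨x₁, hx₁⟩ : ∃ x₁, ς * f x₁ 2 < d := exists_lt_of_ciInf_lt (hbdef ▸ hbd)
  have hexp : Real.exp (-(K * d)) < Real.exp (-(K * (ς * f x₁ 2))) :=
    Real.exp_lt_exp.2 (neg_lt_neg (mul_lt_mul_of_pos_left hx₁ hK))
  -- the bounds on `t` give superharmonicity, and smaller values at `x₁` than at height `d`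
  obtain ⟨t, ht, htC, htx⟩ := exists_pos_mul_le_mul_lt (2 * C)
    (Real.log (0 + Real.log (ellSq l₁ l₂ 0 (f x₁)))) (Real.exp_pos (-(K * (b + 1))))
    (sub_pos.2 hexp)
  set G : M → ℝ := fun y => barrier l₁ l₂ ς t 0 0 (f y) with hG
  have hGeq : ∀ y, G y = -Real.exp (-(K * (ς * f y 2)))
      + t * Real.log (0 + Real.log (ellSq l₁ l₂ 0 (f y))) := fun y => by
    rw [hG]; simp only [barrier]; rw [← hKdef, mul_assoc]
  -- the barrier is large far away
  obtain ⟨R, hR1, hR2⟩ : ∃ R, ellSq l₁ l₂ 0 (f x₁) < R ∧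
      (G x₁ + Real.exp (-(K * b))) / t < Real.log (0 + Real.log R) := by
    have hlim : Tendsto (fun R : ℝ => Real.log (0 + Real.log R)) atTop atTop := by
      simp only [zero_add]
      exact Real.tendsto_log_atTop.comp Real.tendsto_log_atTop
    exact ((eventually_gt_atTop _).and (hlim.eventually_gt_atTop _)).exists
  have hpos : ∀ x, ς * f x 2 ≤ d → 0 < ellSq l₁ l₂ 0 (f x) ∧
      1 < 0 + Real.log (ellSq l₁ l₂ 0 (f x)) := fun x hx => by
    have h1 := hout x hx
    have h0 := (Real.exp_pos 1).trans h1
    refine ⟨h0, ?_⟩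
    rw [zero_add]
    exact (Real.lt_log_iff_exp_lt h0).2 h1
  have hGc : ContinuousOn G {x | ellSq l₁ l₂ 0 (f x) ≤ R ∧ ς * f x 2 ≤ d} := by
    intro x hx
    obtain ⟨h0, h1⟩ := hpos x hx.2
    exact ((contDiffAt_barrier h0 (by linarith)).continuousAt.comp
      hfc.continuousAt).continuousWithinAt
  obtain ⟨y, hy, hmin⟩ := (hcpt R d).exists_isMinOn ⟨x₁, hR1.le, hx₁.le⟩ hGc
  obtain ⟨hy0, hy1⟩ := hpos y hy.2
  have hyx : G y ≤ G x₁ := hmin (show x₁ ∈ _ from ⟨hR1.le, hx₁.le⟩)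
  have hyd : ς * f y 2 < d := by
    refine lt_of_le_of_ne hy.2 fun h => ?_
    have h1 : 0 ≤ t * Real.log (0 + Real.log (ellSq l₁ l₂ 0 (f y))) :=
      mul_nonneg ht.le (Real.log_nonneg hy1.le)
    rw [hGeq, hGeq, h] at hyx
    linarith
  have hyR : ellSq l₁ l₂ 0 (f y) < R := by
    refine lt_of_le_of_ne hy.1 fun h => ?_
    have h1 : Real.exp (-(K * (ς * f y 2))) ≤ Real.exp (-(K * b)) :=
      Real.exp_le_exp.2 (neg_le_neg (mul_le_mul_of_nonneg_left (hb y) hK.le))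
    have h2 := (div_lt_iff₀ ht).1 hR2
    rw [hGeq y, h] at hyx
    linarith
  have hloc : IsLocalMin G y := by
    refine hmin.isLocalMin ?_
    filter_upwards [hσ.continuousAt.eventually (gt_mem_nhds hyR),
      hZ.continuousAt.eventually (gt_mem_nhds hyd)] with z hz1 hz2
    exact ⟨hz1.le, hz2.le⟩
  refine hf.not_isLocalMin_barrier h₂ hl hς ht hy0 hy1.le ?_ hloc
  rw [← hKdef, ← hCdef, mul_assoc K]
  have h1 : Real.exp (-(K * (b + 1))) ≤ Real.exp (-(K * (ς * f y 2))) :=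
    Real.exp_le_exp.2 (neg_le_neg (mul_le_mul_of_nonneg_left (hy.2.trans hd1) hK.le))
  linarith

/-- The strong maximum principle for the height: a minimal surface that touches a horizontal plane
from one side is contained in it. Otherwise there is a point of the surface
off the plane and close to a point of contact; the barrier around the vertical line through it has
an interior minimum near the point of contact closest to this line. -/
theorem IsProperMinimalImmersion.height_eq_of_le [T2Space M] [ConnectedSpace M]
    (hf : IsProperMinimalImmersion l₁ l₂ f)
    (h₂ : 0 < l₂) (hl : l₂ ≤ l₁) {ς : ℝ} (hς : ς = 1 ∨ ς = -1) {b : ℝ}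
    (hb : ∀ x, b ≤ ς * f x 2) {x₁ : M} (hx₁ : ς * f x₁ 2 = b) (x : M) : ς * f x 2 = b := by
  have hfc : Continuous f := hf.proper.continuous
  have hZ : Continuous fun x => ς * f x 2 := by fun_prop
  have hσ : ∀ c, Continuous fun x => ellSq l₁ l₂ c (f x) := fun c =>
    (contDiff_ellSq (n := 1) c).continuous.comp hfc
  have hrate := barrierRate_pos h₂ hl
  have hς0 : ς ≠ 0 := by rcases hς with rfl | rfl <;> norm_num
  have : LocallyCompactSpace M := ChartedSpace.locallyCompactSpace Plane2 M
  set S : Set M := {x | ς * f x 2 = b} with hS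
  have hSc : IsClosed S := isClosed_eq hZ continuous_const
  suffices hSo : IsOpen S by
    have : S = univ := IsClopen.eq_univ ⟨hSc, hSo⟩ ⟨x₁, hx₁⟩
    exact eq_univ_iff_forall.1 this x
  refine isOpen_iff_mem_nhds.2 fun x₀ hx₀ => ?_
  by_contra hnot
  have hfreq : ∃ᶠ y in 𝓝 x₀, y ∉ S := fun h => hnot (by simpa using h)
  -- a compact neighborhood on which the surface is a graph
  obtain ⟨φ, hφ, hφf⟩ := hf.immersion.exists_openPartialHomeomorph hς0 (x := x₀)
    (Eventually.of_forall fun y => (show ς * f x₀ 2 = b from hx₀).trans_le (hb y))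
  obtain ⟨K, hKn, hKφ, hK⟩ := local_compact_nhds (φ.open_source.mem_nhds hφ)
  have hinj : InjOn (fun y => horizProj (f y)) K := (hφf.injOn_iff.2 φ.injOn).mono hKφ
  have hx₀K : x₀ ∈ interior K := mem_interior_iff_mem_nhds.2 hKn
  have hN : IsCompact (K \ interior K) := hK.diff isOpen_interior
  obtain ⟨m, hm, hmN⟩ := hN.exists_forall_le' (hσ (horizProj (f x₀))).continuousOn (a := 0)
    (fun x hx => ellSq_pos h₂ hl fun h => hx.2 (by
      rwa [hinj hx.1 (interior_subset hx₀K) h]))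
  have hcont : Continuous fun q : M × M => ellSq l₁ l₂ (horizProj (f q.1)) (f q.2) :=
    continuous_ellSq_horizProj hfc
  have hnear : ∀ x ∈ K \ interior K, ∀ᶠ q : M × M in 𝓝 (x₀, x),
      m / 2 < ellSq l₁ l₂ (horizProj (f q.1)) (f q.2) := fun x hx =>
    hcont.continuousAt.eventually_const_lt ((half_lt_self hm).trans_le (hmN x hx))
  have hev1 : ∀ᶠ y in 𝓝 x₀, ∀ x ∈ K \ interior K,
      m / 2 < ellSq l₁ l₂ (horizProj (f y)) (f x) :=
    hN.eventually_forall_of_forall_eventually hnear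
  have hev2 : ∀ᶠ y in 𝓝 x₀, ellSq l₁ l₂ (horizProj (f y)) (f x₀) < m / 2 := by
    refine (hcont.comp (Continuous.prodMk continuous_id
      (continuous_const (y := x₀)))).continuousAt.eventually (gt_mem_nhds ?_)
    simp only [Function.comp, id, ellSq_horizProj]
    linarith
  obtain ⟨y, hyS, hy1, hy2, hyK⟩ :=
    (hfreq.and_eventually (hev1.and (hev2.and hKn))).exists
  set c := horizProj (f y) with hc
  -- the point of contact closest to the axis
  obtain ⟨q, hq, hqmin⟩ := (hK.inter_right hSc).exists_isMinOn
    ⟨x₀, interior_subset hx₀K, hx₀⟩ (hσ c).continuousOn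
  obtain ⟨r, hr⟩ : ∃ r, ellSq l₁ l₂ c (f q) = r := ⟨_, rfl⟩
  have hrpos : 0 < r := hr ▸ ellSq_pos h₂ hl fun h => hyS (by
    rw [← hinj hq.1 hyK h]; exact hq.2)
  have hrm : r < m / 2 := by
    rw [← hr]
    exact (hqmin (show x₀ ∈ K ∩ S from ⟨interior_subset hx₀K, hx₀⟩)).trans_lt hy2
  have hSr : ∀ x ∈ K, x ∈ S → r ≤ ellSq l₁ l₂ c (f x) := fun x h h' => by
    rw [← hr]; exact hqmin (show x ∈ K ∩ S from ⟨h, h'⟩)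
  -- with this `ℓ`, the double logarithm vanishes on the inner cylinder and increases outward
  obtain ⟨ℓ, hℓ⟩ : ∃ ℓ, ℓ = 1 - Real.log (r / 4) := ⟨_, rfl⟩
  have hlog : ∀ s, r / 4 ≤ s → 1 ≤ ℓ + Real.log s := fun s hs => by
    have := Real.log_le_log (by positivity) hs
    rw [hℓ]; linarith
  have hC := barrierConst_pos h₂ hl ℓ
  set k := barrierRate l₁ l₂ with hk
  set C := barrierConst l₁ l₂ ℓ with hCdef
  -- the surface stays away from the plane on the inner cylinder
  obtain ⟨b', hbb', hb'⟩ := (hK.inter_right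
    (isClosed_eq (hσ c) (continuous_const (y := r / 4)))).exists_forall_le' hZ.continuousOn
    (a := b) (fun x hx => lt_of_le_of_ne (hb x) fun h => by
      have h1 := hSr x hx.1 h.symm
      have h2 : ellSq l₁ l₂ c (f x) = r / 4 := hx.2
      linarith)
  have hexpc : Continuous fun x => Real.exp (-(k * (ς * f x 2))) := by fun_prop
  obtain ⟨P, hP, hPle⟩ := hK.exists_forall_le' hexpc.continuousOn (a := 0)
    (fun x _ => Real.exp_pos _)
  have hexp : Real.exp (-(k * b')) < Real.exp (-(k * b)) :=
    Real.exp_lt_exp.2 (neg_lt_neg (mul_lt_mul_of_pos_left hbb' hrate))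
  -- the bounds on `t` give superharmonicity, and smaller values at `q` than on the inner cylinder
  obtain ⟨t, ht, htC, htr⟩ := exists_pos_mul_le_mul_lt (2 * C)
    (Real.log (ℓ + Real.log r)) hP (sub_pos.2 hexp)
  set G : M → ℝ := fun y => barrier l₁ l₂ ς t ℓ c (f y) with hG
  have hGeq : ∀ y, G y = -Real.exp (-(k * (ς * f y 2)))
      + t * Real.log (ℓ + Real.log (ellSq l₁ l₂ c (f y))) := fun y => by
    rw [hG]; simp only [barrier]; rw [← hk, mul_assoc]
  set Q : Set M := K ∩ {x | r / 4 ≤ ellSq l₁ l₂ c (f x) ∧ ellSq l₁ l₂ c (f x) ≤ m / 2} with hQ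
  have hQc : IsCompact Q := hK.inter_right
    ((isClosed_le continuous_const (hσ c)).inter (isClosed_le (hσ c) continuous_const))
  have hqQ : q ∈ Q := ⟨hq.1, by rw [hr]; linarith, by rw [hr]; exact hrm.le⟩
  have hGc : ContinuousOn G Q := fun x hx =>
    ((contDiffAt_barrier (by linarith [hx.2.1]) (by linarith [hlog _ hx.2.1])).continuousAt.comp
      hfc.continuousAt).continuousWithinAt
  obtain ⟨z, hz, hzmin⟩ := hQc.exists_isMinOn ⟨q, hqQ⟩ hGc
  have hzq : G z ≤ G q := hzmin hqQ
  rw [hGeq, hGeq, hr, show ς * f q 2 = b from hq.2] at hzq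
  have hz1 : r / 4 < ellSq l₁ l₂ c (f z) := by
    refine lt_of_le_of_ne hz.2.1 fun h => ?_
    have h1 : Real.exp (-(k * (ς * f z 2))) ≤ Real.exp (-(k * b')) :=
      Real.exp_le_exp.2 (neg_le_neg (mul_le_mul_of_nonneg_left (hb' z ⟨hz.1, h.symm⟩) hrate.le))
    rw [← h, hℓ, sub_add_cancel, Real.log_one, ← hℓ] at hzq
    linarith
  have hz2 : ellSq l₁ l₂ c (f z) < m / 2 := by
    refine lt_of_le_of_ne hz.2.2 fun h => ?_
    have h1 : Real.exp (-(k * (ς * f z 2))) ≤ Real.exp (-(k * b)) :=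
      Real.exp_le_exp.2 (neg_le_neg (mul_le_mul_of_nonneg_left (hb z) hrate.le))
    have h3 := Real.log_lt_log hrpos hrm
    have h4 : Real.log (ℓ + Real.log r) < Real.log (ℓ + Real.log (m / 2)) :=
      Real.log_lt_log (by linarith [hlog r (by linarith)]) (by linarith)
    have h5 := mul_lt_mul_of_pos_left h4 ht
    rw [h] at hzq
    linarith
  have hzK : z ∈ interior K := by
    by_contra h
    exact absurd (hy1 z ⟨hz.1, h⟩) (not_lt.2 hz2.le)
  have hloc : IsLocalMin G z := by
    refine hzmin.isLocalMin ?_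
    filter_upwards [isOpen_interior.mem_nhds hzK,
      (hσ c).continuousAt.eventually (lt_mem_nhds hz1),
      (hσ c).continuousAt.eventually (gt_mem_nhds hz2)] with w hw1 hw2 hw3
    exact ⟨interior_subset hw1, hw2.le, hw3.le⟩
  refine hf.not_isLocalMin_barrier h₂ hl hς ht (by linarith) (hlog _ hz1.le) ?_ hloc
  rw [← hk, ← hCdef, mul_assoc k]
  linarith [hPle z hz.1]

/-- A properly immersed connected surface contained in a horizontal plane is that plane. -/
theorem range_eq_and_injective_of_height_eq [T2Space M] [ConnectedSpace M]
    (hf : IsSmoothImmersion f) (hprop : IsProperMap f) {b : ℝ} (hb : ∀ x, f x 2 = b) :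
    range f = horizontalPlane b ∧ Function.Injective f := by
  have hloc : IsLocalHomeomorph fun x => horizProj (f x) := IsLocalHomeomorph.mk _ fun x =>
    hf.exists_openPartialHomeomorph one_ne_zero (Eventually.of_forall fun y => by
      simp only [hb, le_refl])
  let ι : Plane2 → E2Tilde := fun q => !₂[q 0, q 1, b]
  have hι : Continuous ι := by
    have h : Continuous fun q : Plane2 => (![q 0, q 1, b] : Fin 3 → ℝ) := by
      refine continuous_pi fun i => ?_
      fin_cases i
      · exact (EuclideanSpace.proj (𝕜 := ℝ) (0 : Fin 2)).continuous
      · exact (EuclideanSpace.proj (𝕜 := ℝ) (1 : Fin 2)).continuous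
      · exact continuous_const
    exact (PiLp.continuous_toLp 2 _).comp h
  have hιinj : Function.Injective ι := fun p q h => by
    ext i
    fin_cases i
    · exact congrArg (fun v : E2Tilde => v 0) h
    · exact congrArg (fun v : E2Tilde => v 1) h
  have hιf : ι ∘ (fun x => horizProj (f x)) = f := by
    ext x i
    fin_cases i
    · rfl
    · rfl
    · exact (hb x).symm
  have hpr : IsProperMap fun x => horizProj (f x) :=
    isProperMap_of_comp_of_inj hloc.continuous hι (by rw [hιf]; exact hprop) hιinj
  have hbij := hloc.bijective_of_isProperMap hpr
  refine ⟨Subset.antisymm ?_ ?_, ?_⟩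
  · rintro _ ⟨x, rfl⟩
    exact hb x
  · intro p hp
    obtain ⟨x, hx⟩ := hbij.2 (horizProj p)
    refine ⟨x, ?_⟩
    rw [← congrFun hιf x]
    refine (congrArg ι hx).trans ?_
    ext i
    fin_cases i
    · rfl
    · rfl
    · exact (show p 2 = b from hp).symm
  · exact fun x y h => hbij.1 (congrArg horizProj h)

end E2Tilde

theorem theorem6p1 (l₁ l₂ : ℝ) (hl₂ : 0 < l₂) (hl : l₂ ≤ l₁)
    {M : Type*} [TopologicalSpace M] [T2Space M] [SecondCountableTopology M] [ConnectedSpace M]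
    [ChartedSpace Plane2 M] [IsManifold (𝓡 2) ∞ M]
    (f : M → E2Tilde) (hf : E2Tilde.IsProperMinimalImmersion l₁ l₂ f)
    (a : ℝ) (hside : (∀ x, f x 2 ≤ a) ∨ (∀ x, a ≤ f x 2)) :
    ∃ b : ℝ, Set.range f = E2Tilde.horizontalPlane b ∧ Function.Injective f := by
  obtain ⟨ς, a', hς, ha'⟩ : ∃ ς a' : ℝ, (ς = 1 ∨ ς = -1) ∧ ∀ x, a' ≤ ς * f x 2 := by
    rcases hside with h | h
    · exact ⟨-1, -a, Or.inr rfl, fun x => by linarith [h x]⟩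
    · exact ⟨1, a, Or.inl rfl, fun x => by linarith [h x]⟩
  obtain ⟨x₀, hx₀⟩ := hf.exists_forall_height_le hl₂ hl hς ha'
  have hconst := hf.height_eq_of_le hl₂ hl hς hx₀ rfl
  refine ⟨f x₀ 2, E2Tilde.range_eq_and_injective_of_height_eq hf.immersion hf.proper fun x => ?_⟩
  have := hconst x
  rcases hς with rfl | rfl <;> linarith
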